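/- Let $k$ be a field, let $A=k[[X,Y,Z,W]]/\big((X^2,Y^2)\cap(Z,W)\big)$, a local ring with maximal ideal $\mathfrak m$, and let $x,y,z,w$ be the images of $X,Y,Z,W$ in $A$. Put $$I=\mathfrak m^2+(z,w),\qquad Q=(x^2-z,\;y^2-w),\qquad Q'=(xy-z,\;x^2+y^2-w).$$ Then $Q$ and $Q'$ are minimal reductions of $I$, and $I=\overline{Q}=\overline{Q'}$, where $\overline{\mathfrak a}$ denotes the integral closure of an ideal $\mathfrak a$. For an ideal $\mathfrak q$ write $\mathcal R(\mathfrak q)=A[\mathfrak q t]\subseteq A[t]$ for its Rees algebra, and for a reduction $\mathfrak q$ of $I$ let $$S_{\mathfrak q}(I)=I\mathcal R(I)/I\mathcal R(\mathfrak q)\cong\bigoplus_{n\ge 1}I^{n+1}/\mathfrak q^nI$$ be the Sally module of $I$ with respect to $\mathfrak q$, a graded $\mathcal R(\mathfrak q)$-module whose component of degree $n$ is $I^{n+1}/\mathfrak q^nI$. Put $T=\mathcal R(Q)$, $T'=\mathcal R(Q')$, $B=T/\mathfrak mT$, $B'=T'/\mathfrak mT'$, and let $B_+$ be the ideal of $B$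 generated by the homogeneous elements of positive degree. Then: 1. $S_Q(I)\cong B_+$ as graded $T$-modules. 2. $S_{Q'}(I)\cong\big(B'/(x^2+y^2-w)t\cdot B'\big)(-1)$ as graded $T'$-modules, where $N(-1)$ is the module $N$ with the grading $N(-1)_n=N_{n-1}$. 3. $\ell_A(A/I^{n+1})=8\binom{n+2}{2}-2\binom{n+1}{1}-4$ for all $n\ge 1$. Moreover $B$ and $B'$ are domains, $\mathfrak m$ annihilates $S_Q(I)$ and $S_{Q'}(I)$, and $\operatorname{rank}_B S_Q(I)=1$ while $\operatorname{rank}_{B'}S_{Q'}(I)=0$. Hence the rank of the Sally module of $I$ depends on the choice of the minimal reduction. -/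

import Mathlib

open Polynomial

noncomputable section

section IdealNotions

variable {A : Type*} [CommRing A]

/-- `Q` is a reduction of `I`: `Q ⊆ I` and `I ^ (n + 1) = Q * I ^ n` for some `n`. -/
def IsIdealReduction (Q I : Ideal A) : Prop :=
  Q ≤ I ∧ ∃ n : ℕ, I ^ (n + 1) = Q * I ^ n

/-- `Q` is a reduction of `I` and properly contains no other reduction of `I`. -/
def IsMinimalIdealReduction (Q I : Ideal A) : Prop :=
  IsIdealReduction Q I ∧ ∀ K : Ideal A, IsIdealReduction K I → K ≤ Q → K = Q

/-- The integral closure of the ideal `Q`: all `r` with an equation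
`r ^ n + a₁ r ^ (n - 1) + ⋯ + aₙ = 0`, where `n ≥ 1` and `aᵢ ∈ Q ^ i`. -/
def idealIntegralClosure (Q : Ideal A) : Set A :=
  {r | ∃ n : ℕ, 0 < n ∧ ∃ a : ℕ → A, (∀ i, a i ∈ Q ^ i) ∧
    r ^ n + ∑ i ∈ Finset.Icc 1 n, a i * r ^ (n - i) = 0}

/-- The Rees algebra `R(Q) = A[Qt]` of the ideal `Q`, that is Mathlib's subalgebra
`reesAlgebra Q` of `A[t]`, as a ring. -/
def Rees (Q : Ideal A) : Type _ := ↥(reesAlgebra Q)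

instance (Q : Ideal A) : CommRing (Rees Q) := inferInstanceAs (CommRing (reesAlgebra Q))

instance (Q : Ideal A) : Algebra A (Rees Q) := inferInstanceAs (Algebra A (reesAlgebra Q))

/-- `A[t]` is an algebra over `R(Q)` through the inclusion `R(Q) ⊆ A[t]`. -/
instance (Q : Ideal A) : Algebra (Rees Q) A[X] := inferInstanceAs (Algebra (reesAlgebra Q) A[X])

/-- The product `I · R(J) ⊆ A[t]`, as a module over the Rees algebra `R(Q)`. -/
def mulRees (Q I J : Ideal A) : Submodule (Rees Q) A[X] :=
  Submodule.span (Rees Q) {p | ∃ a ∈ I, ∃ f ∈ reesAlgebra J, p = C a * f}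

/-- When `Q ⊆ J`, the product `I · R(J)` is `⨁ₙ I Jⁿ tⁿ`. -/
theorem mem_mulRees_iff {Q I J : Ideal A} (hQJ : Q ≤ J) (f : A[X]) :
    f ∈ mulRees Q I J ↔ ∀ n, f.coeff n ∈ I * J ^ n := by
  constructor
  · intro hf
    refine Submodule.span_induction (p := fun g _ => ∀ n, g.coeff n ∈ I * J ^ n)
      ?_ ?_ ?_ ?_ hf
    · rintro _ ⟨a, ha, g, hg, rfl⟩ n
      rw [coeff_C_mul]
      exact Ideal.mul_mem_mul ha (hg n)
    · intro n
      simp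
    · intro g h _ _ hg hh n
      rw [coeff_add]
      exact Ideal.add_mem _ (hg n) (hh n)
    · intro r g _ hg n
      have hr : ∀ i, (algebraMap (Rees Q) A[X] r).coeff i ∈ Q ^ i := r.2
      rw [Algebra.smul_def, coeff_mul]
      refine Ideal.sum_mem _ ?_
      rintro ⟨i, j⟩ hij
      rw [← Finset.HasAntidiagonal.mem_antidiagonal.mp hij, pow_add, mul_left_comm]
      exact Ideal.mul_mem_mul (Ideal.pow_right_mono hQJ i (hr i)) (hg j)
  · intro hf
    rw [f.as_sum_support]
    refine Submodule.sum_mem _ fun n _ => ?_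
    have key : ∀ c ∈ I * J ^ n, monomial n c ∈ mulRees Q I J := by
      intro c hc
      refine Submodule.mul_induction_on hc ?_ ?_
      · intro a ha b hb
        refine Submodule.subset_span ⟨a, ha, monomial n b, ?_, ?_⟩
        · exact reesAlgebra.monomial_mem.mpr hb
        · rw [C_mul_monomial]
      · intro c d hc hd
        rw [map_add]
        exact Submodule.add_mem _ hc hd
    exact key _ (hf n)

/-- The Sally module `S_Q(I) = I R(I) / I R(Q)`, a module over the Rees algebra `R(Q)`. -/
abbrev SallyModule (Q I : Ideal A) : Type _ :=
  ↥(mulRees Q I I) ⧸ (mulRees Q I Q).submoduleOf (mulRees Q I I)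

/-- The degree `n` part of the Sally module: the classes of the elements `c tⁿ` of `I R(I)`. -/
def sallyDegree (Q I : Ideal A) (n : ℕ) : AddSubgroup (SallyModule Q I) :=
  (((LinearMap.range (monomial (R := A) n)).toAddSubgroup.comap
    (mulRees Q I I).subtype.toAddMonoidHom)).map
      ((mulRees Q I Q).submoduleOf (mulRees Q I I)).mkQ.toAddMonoidHom

/-- The degree `n` part `Qⁿ tⁿ` of the Rees algebra of `Q`. -/
def reesDegree (Q : Ideal A) (n : ℕ) : AddSubgroup (Rees Q) :=
  (LinearMap.range (monomial (R := A) n)).toAddSubgroup.comap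
    (algebraMap (Rees Q) A[X]).toAddMonoidHom

/-- For a quotient ring `C` of `R(Q)` by a homogeneous ideal, its degree `n` part, that is the
image of the degree `n` part of `R(Q)`. -/
def inducedDegree (Q : Ideal A) (C : Type*) [CommRing C] [Algebra (Rees Q) C] (n : ℕ) :
    AddSubgroup C :=
  (reesDegree Q n).map (algebraMap (Rees Q) C).toAddMonoidHom

/-- The element `a t` of the Rees algebra of `Q`, for `a ∈ Q`. -/
def reesT (Q : Ideal A) (a : A) (ha : a ∈ Q) : Rees Q :=
  ⟨monomial 1 a, reesAlgebra.monomial_mem.mpr (by rwa [pow_one])⟩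

/-- The grading of the shifted module `N(-1)`: `N(-1)₀ = 0` and `N(-1)ₙ₊₁ = Nₙ`. -/
def shiftDegree {N : Type*} [AddCommGroup N] (𝒩 : ℕ → AddSubgroup N) : ℕ → AddSubgroup N
  | 0 => ⊥
  | n + 1 => 𝒩 n

/-- The `T`-modules `M` and `N`, with the degree parts `ℳ n` and `𝒩 n`, are isomorphic by a
`T`-linear bijection that identifies the parts of each degree. -/
def GradedIso (T : Type*) [CommRing T] {M N : Type*} [AddCommGroup M] [Module T M]
    [AddCommGroup N] [Module T N] (ℳ : ℕ → AddSubgroup M) (𝒩 : ℕ → AddSubgroup N) : Prop :=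
  ∃ e : M ≃ₗ[T] N, ∀ (n : ℕ) (m : M), m ∈ ℳ n ↔ e m ∈ 𝒩 n

end IdealNotions

section FiberCone

variable {A : Type*} [CommRing A] [IsLocalRing A]

/-- The ideal `𝔪 R(Q)` of the Rees algebra of `Q`. -/
def fiberIdeal (Q : Ideal A) : Ideal (Rees Q) :=
  (IsLocalRing.maximalIdeal A).map (algebraMap A (Rees Q))

/-- The fiber cone `R(Q) / 𝔪 R(Q)`. -/
abbrev FiberCone (Q : Ideal A) : Type _ := Rees Q ⧸ fiberIdeal Q

/-- The ideal `B₊` of `B = R(Q) / 𝔪 R(Q)` generated by the elements of positive degree. -/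
def fiberConePlus (Q : Ideal A) : Ideal (FiberCone Q) :=
  Ideal.span {b | ∃ n : ℕ, 0 < n ∧ b ∈ inducedDegree Q (FiberCone Q) n}

/-- The degree `n` part of `B₊`. -/
def fiberConePlusDegree (Q : Ideal A) (n : ℕ) : AddSubgroup (fiberConePlus Q) :=
  (inducedDegree Q (FiberCone Q) n).comap (fiberConePlus Q).subtype.toAddMonoidHom

/-- `B / (a t) B`, where `B = R(Q) / 𝔪 R(Q)` and `a ∈ Q`. -/
abbrev FiberConeMod (Q : Ideal A) (a : A) (ha : a ∈ Q) : Type _ :=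
  FiberCone Q ⧸ Ideal.span {algebraMap (Rees Q) (FiberCone Q) (reesT Q a ha)}

/-- `B = R(Q) / 𝔪 R(Q)` is a domain, `𝔪 R(Q)` annihilates `M`, and `M` has rank `r` as a module
over `B`. -/
def HasFiberConeRank (Q : Ideal A) (M : Type*) [AddCommGroup M] [Module (Rees Q) M]
    (r : Cardinal) : Prop :=
  IsDomain (FiberCone Q) ∧
    ∃ h : Module.IsTorsionBySet (Rees Q) M (fiberIdeal Q : Set (Rees Q)),
      letI : Module (FiberCone Q) M := h.module
      Module.rank (FiberCone Q) M = r

end FiberCone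

namespace SallyExample

variable (k : Type*) [Field k]

/-- The ideal `(X², Y²) ∩ (Z, W)` of `k[[X, Y, Z, W]]`. -/
def relations : Ideal (MvPowerSeries (Fin 4) k) :=
  Ideal.span {MvPowerSeries.X 0 ^ 2, MvPowerSeries.X 1 ^ 2} ⊓
    Ideal.span {MvPowerSeries.X 2, MvPowerSeries.X 3}

/-- The ring `A = k[[X, Y, Z, W]] / ((X², Y²) ∩ (Z, W))`. -/
def ExRing : Type _ := MvPowerSeries (Fin 4) k ⧸ relations k

instance : CommRing (ExRing k) := inferInstanceAs (CommRing (MvPowerSeries (Fin 4) k ⧸ relations k))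

/-- The canonical map `k[[X, Y, Z, W]] → A`. -/
def toExRing : MvPowerSeries (Fin 4) k →+* ExRing k := Ideal.Quotient.mk (relations k)

theorem relations_ne_top : relations k ≠ ⊤ := by
  intro h
  have h1 : Ideal.span {MvPowerSeries.X 2, MvPowerSeries.X 3} ≤
      RingHom.ker (MvPowerSeries.constantCoeff (σ := Fin 4) (R := k)) := by
    rw [Ideal.span_le]
    rintro _ (rfl | rfl) <;> simp [RingHom.mem_ker]
  have h2 : (1 : MvPowerSeries (Fin 4) k) ∈ relations k := by
    rw [h]
    trivial
  have h3 := h1 h2.2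
  simp [RingHom.mem_ker] at h3

instance : Nontrivial (ExRing k) := Ideal.Quotient.nontrivial_iff.mpr (relations_ne_top k)

instance : IsLocalRing (ExRing k) :=
  IsLocalRing.of_surjective' (toExRing k) Ideal.Quotient.mk_surjective

def x : ExRing k := toExRing k (MvPowerSeries.X 0)

def y : ExRing k := toExRing k (MvPowerSeries.X 1)

def z : ExRing k := toExRing k (MvPowerSeries.X 2)

def w : ExRing k := toExRing k (MvPowerSeries.X 3)

/-- `I = 𝔪² + (z, w)`. -/
def I : Ideal (ExRing k) :=
  IsLocalRing.maximalIdeal (ExRing k) ^ 2 ⊔ Ideal.span {z k, w k}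

/-- `Q = (x² - z, y² - w)`. -/
def Q : Ideal (ExRing k) :=
  Ideal.span {x k ^ 2 - z k, y k ^ 2 - w k}

/-- `Q' = (xy - z, x² + y² - w)`. -/
def Q' : Ideal (ExRing k) :=
  Ideal.span {x k * y k - z k, x k ^ 2 + y k ^ 2 - w k}

/-- The generator `x² + y² - w` lies in `Q'`. -/
theorem b'_mem : x k ^ 2 + y k ^ 2 - w k ∈ Q' k :=
  Ideal.subset_span (Or.inr rfl)

end SallyExample

end

/-! Give x, y weight 1 and z, w weight 2. Then I^m consists of the elements of weight at least 2m,
and A is glued from two pieces: k[[X,Y]], where z = w = 0, and k[[X,Y,Z,W]]/(X²,Y²). All lower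
bounds come from arcs, that is homomorphisms A → E[[T]] with x ↦ pT, y ↦ qT, z ↦ rT², w ↦ sT². Such
an arc exists as soon as r = s = 0 or p² = q² = 0 (`exists_arc`), and it sends I into (T²).

Minimality and fiber cones. Over an algebraic closure of k, arcs with z = w = 0 send the two
generators of Q, or of Q', to uT² and vT² with u, v arbitrary. Hence the generators are analytically
independent and the fiber cone is k[U,V] (`HasQuadraticArcs.exists_fiberConeHom`); the same arcs
show that no smaller ideal is a reduction. The determinant trick puts I into the integral closure of
a reduction; the T-order along arcs gives the other inclusion.

Sally modules. Modulo Q one may exchange z with x² and w with y². With x²z = x²w = y²z = y²w = 0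
this leaves I^(n+1) = I Qⁿ + xy(z,w)ⁿ for n ≥ 1, and the maximal ideal sends the second summand into
I Qⁿ. So the degree n part of S_Q(I) is a quotient of the space of n-forms in two variables. Modulo
Q' one exchanges z with xy and w with x² + y², and only the multiples of xyzⁿ survive, so the degree
n part has dimension at most one.

That nothing more collapses is shown by forms lₙ on I^(n+1) (`exists_forms_Q`, `exists_forms_Q'`).
Each combines the coefficients of T^(2n+2) along two arcs, one in each piece of A, which agree on
the generators of the reduction. The combination is chosen to vanish on I for n = 0, hence on I Qⁿ,
but not on the surviving elements. By `exists_sallyHom` the Sally modules become the ideal (U,V) of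
k[U,V], of rank one, and X²k[X], which is killed by the second variable of the fiber cone and so has
rank zero.

The Hilbert function counts the monomials of weight less than 2m that are nonzero in A. -/

/-! ### Reductions and integral closure: the determinant trick -/

section IntegralClosure

variable {A : Type*} [CommRing A]

/-- Multiplication by r maps Iⁿ into I^(n+1) = Q Iⁿ, so Cayley–Hamilton gives a monic p with
coefficients in powers of Q and p(r) Iⁿ = 0. The module Iⁿ need not be faithful, but it contains rⁿ,
so p(r) rⁿ = 0 is already an equation of integral dependence. -/
theorem mem_idealIntegralClosure_of_isIdealReduction {Q I : Ideal A} (hI : I.FG)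
    (h : IsIdealReduction Q I) {r : A} (hr : r ∈ I) : r ∈ idealIntegralClosure Q := by
  obtain ⟨-, n, hn⟩ := h
  have : Module.Finite A ↥(I ^ n) := Module.Finite.iff_fg.mpr (hI.pow)
  let f : Module.End A ↥(I ^ n) := r • LinearMap.id
  have hf : LinearMap.range f ≤ Q • ⊤ := by
    rintro _ ⟨u, rfl⟩
    rw [Submodule.mem_smul_top_iff]
    change r * (u : A) ∈ Q * I ^ n
    rw [← hn, pow_succ']
    exact Ideal.mul_mem_mul hr u.2
  obtain ⟨p, hp, -, hc, hp0⟩ :=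
    LinearMap.exists_monic_and_natDegree_eq_and_coeff_mem_pow_and_aeval_eq_zero A f Q hf
  have hfr : f = algebraMap A (Module.End A ↥(I ^ n)) r := by
    ext u; simp [f, Module.algebraMap_end_apply]
  have h1 : p.eval r * r ^ n = 0 := by
    rw [hfr, aeval_algebraMap_apply] at hp0
    have := congrArg (fun g => ((g ⟨r ^ n, Ideal.pow_mem_pow hr n⟩ : ↥(I ^ n)) : A)) hp0
    simpa [Module.algebraMap_end_apply] using this
  set d := p.natDegree with hd
  let a : ℕ → A := fun i => if i ≤ d then p.coeff (d - i) else 0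
  have ha : ∀ i, a i ∈ Q ^ i := by
    intro i
    simp only [a]
    split_ifs with hi
    · have := hc (d - i)
      rwa [Nat.sub_sub_self hi] at this
    · exact Ideal.zero_mem _
  -- One more factor r than p(r) rⁿ = 0 requires: it keeps the degree positive even when n = d = 0.
  refine ⟨n + 1 + d, by omega, a, ha, ?_⟩
  have h2 : ∑ i ∈ Finset.range (n + 1 + d + 1), a i * r ^ (n + 1 + d - i) = 0 := by
    have hsub : Finset.range (d + 1) ⊆ Finset.range (n + 1 + d + 1) := by
      intro i; simp; omega
    rw [← Finset.sum_subset hsub]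
    · have h3 : p.eval r * r ^ (n + 1) = 0 := by rw [pow_succ, ← mul_assoc, h1, zero_mul]
      rw [← h3, eval_eq_sum_range, Finset.sum_mul, ← hd, ← Finset.sum_range_reflect]
      refine Finset.sum_congr rfl fun i hi => ?_
      have hi' : i ≤ d := by simpa [Nat.lt_succ_iff] using hi
      have hai : a (d + 1 - 1 - i) = p.coeff i := by
        rw [show d + 1 - 1 - i = d - i by omega]
        simp only [a, if_pos (Nat.sub_le d i), Nat.sub_sub_self hi']
      rw [hai, mul_assoc, ← pow_add, show n + 1 + d - (d + 1 - 1 - i) = i + (n + 1) by omega]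
    · intro i _ hi
      have : ¬ i ≤ d := by simpa [Nat.lt_succ_iff] using hi
      simp [a, this]
  rw [Finset.range_eq_Ico, Finset.sum_eq_sum_Ico_succ_bot (by omega)] at h2
  have ha0 : a 0 = 1 := by simp [a, hd, hp.coeff_natDegree]
  rw [ha0, one_mul, Nat.sub_zero] at h2
  exact h2

end IntegralClosure

/-! ### Graded modules compared through embeddings into a ring -/

section GradedIso

/-- Both modules embed in K, viewed as a T-module through φ, with the same image, and the sets `D n`
read off the degree inside K. No map between the two quotients has to be written down. -/
theorem gradedIso_of_semilinear {T K M N : Type*} [CommRing T] [CommRing K] [AddCommGroup M]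
    [Module T M] [AddCommGroup N] [Module T N] (φ : T →+* K) {ℳ : ℕ → AddSubgroup M}
    {𝒩 : ℕ → AddSubgroup N} (D : ℕ → Set K) (f : M →+ K) (g : N →+ K)
    (hf : ∀ r m, f (r • m) = φ r * f m) (hg : ∀ r m, g (r • m) = φ r * g m)
    (hfi : Function.Injective f) (hgi : Function.Injective g) (hfg : f.range = g.range)
    (hfD : ∀ n m, m ∈ ℳ n ↔ f m ∈ D n) (hgD : ∀ n m, m ∈ 𝒩 n ↔ g m ∈ D n) :
    GradedIso T ℳ 𝒩 := by
  let _ : Module T K := Module.compHom K φ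
  let f' : M →ₗ[T] K := { f with map_smul' := hf }
  let g' : N →ₗ[T] K := { g with map_smul' := hg }
  have hr : LinearMap.range f' = LinearMap.range g' := by
    ext v
    exact SetLike.ext_iff.mp hfg v
  let e : M ≃ₗ[T] N := (LinearEquiv.ofInjective f' hfi).trans
    ((LinearEquiv.ofEq _ _ hr).trans (LinearEquiv.ofInjective g' hgi).symm)
  have he : ∀ m, g (e m) = f m := by
    intro m
    have : (LinearEquiv.ofInjective g' hgi (e m) : K) = f' m := by
      simp [e]
    exact this
  exact ⟨e, fun n m => by rw [hfD, hgD, he]⟩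

end GradedIso

section ReesInduction

variable {A : Type*} [CommRing A]

/-- The Rees algebra of (a, b) is generated over A by at and bt. -/
theorem Rees.induction {Q : Ideal A} {a b : A} (hQ : Q = Ideal.span {a, b}) (ha : a ∈ Q)
    (hb : b ∈ Q) {P : Rees Q → Prop} (hC : ∀ c, P (algebraMap A (Rees Q) c))
    (hPa : P (reesT Q a ha)) (hPb : P (reesT Q b hb))
    (hadd : ∀ r s, P r → P s → P (r + s)) (hmul : ∀ r s, P r → P s → P (r * s))
    (r : Rees Q) : P r := by
  let S : Subalgebra A (Rees Q) :=
    { carrier := {r | P r}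
      mul_mem' := fun h1 h2 => hmul _ _ h1 h2
      add_mem' := fun h1 h2 => hadd _ _ h1 h2
      algebraMap_mem' := hC }
  suffices h : ∀ f : A[X], f ∈ reesAlgebra Q → ∃ s : Rees Q, s ∈ S ∧ s.1 = f by
    obtain ⟨s, hs, h⟩ := h r.1 r.2
    have : s = r := Subtype.ext h
    exact this ▸ hs
  intro f hf
  rw [← adjoin_monomial_eq_reesAlgebra] at hf
  have hle : Algebra.adjoin A (Submodule.map (monomial 1 : A →ₗ[A] A[X]) Q : Set A[X]) ≤
      S.map (reesAlgebra Q).val := by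
    rw [Algebra.adjoin_le_iff]
    rintro _ ⟨c, hc, rfl⟩
    have hc' : c ∈ Ideal.span {a, b} := hQ ▸ hc
    obtain ⟨u, v, rfl⟩ := Ideal.mem_span_pair.mp hc'
    refine ⟨algebraMap A (Rees Q) u * reesT Q a ha + algebraMap A (Rees Q) v * reesT Q b hb,
      hadd _ _ (hmul _ _ (hC u) hPa) (hmul _ _ (hC v) hPb), ?_⟩
    change C u * monomial 1 a + C v * monomial 1 b = _
    simp [C_mul_monomial]
  obtain ⟨s, hs, h⟩ := hle hf
  exact ⟨s, hs, h⟩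

end ReesInduction

section SallyHom

variable {A K : Type*} [CommRing A] [CommRing K]

/-- The additive map `A[t] → K` that sends `c tⁿ` to `l n c`. -/
noncomputable def coeffwiseHom (l : ℕ → A →+ K) : A[X] →+ K where
  toFun g := g.sum fun n c => l n c
  map_zero' := by simp
  map_add' g h := sum_add_index g h _ (fun i => map_zero (l i)) (fun i => map_add (l i))

theorem coeffwiseHom_monomial (l : ℕ → A →+ K) (n : ℕ) (c : A) :
    coeffwiseHom l (monomial n c) = l n c :=
  sum_monomial_index c (fun n c => l n c) (map_zero (l n))

theorem mulRees_induction {Q I : Ideal A} (hQI : Q ≤ I) {P : A[X] → Prop} (h0 : P 0)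
    (hadd : ∀ f g, P f → P g → P (f + g)) (hmon : ∀ n, ∀ c ∈ I ^ (n + 1), P (monomial n c))
    {g : A[X]} (hg : g ∈ mulRees Q I I) : P g := by
  rw [mem_mulRees_iff hQI] at hg
  rw [g.as_sum_support]
  refine Finset.sum_induction _ P hadd h0 fun n _ => hmon n _ ?_
  rw [pow_succ']
  exact hg n

/-- Maps `I ^ (n + 1) → K` that are compatible with the multiplication by the generators of the
Rees algebra and vanish exactly on `I Qⁿ` give an embedding of the Sally module into `K`. -/
theorem exists_sallyHom {Q I : Ideal A} {a b : A} (hQ : Q = Ideal.span {a, b}) (ha : a ∈ Q)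
    (hb : b ∈ Q) (hQI : Q ≤ I) (φ : Rees Q →+* K) (l : ℕ → A →+ K) (pr : ℕ → K →+ K)
    (hC : ∀ c n, ∀ g ∈ I ^ (n + 1), l n (c * g) = φ (algebraMap A (Rees Q) c) * l n g)
    (hla : ∀ n, ∀ g ∈ I ^ (n + 1), l (n + 1) (a * g) = φ (reesT Q a ha) * l n g)
    (hlb : ∀ n, ∀ g ∈ I ^ (n + 1), l (n + 1) (b * g) = φ (reesT Q b hb) * l n g)
    (hpr : ∀ n, ∀ g ∈ I ^ (n + 1), ∀ j, pr j (l n g) = if j = n then l n g else 0)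
    (hker : ∀ n, ∀ g ∈ I ^ (n + 1), l n g = 0 ↔ g ∈ I * Q ^ n) :
    ∃ f : SallyModule Q I →+ K, Function.Injective f ∧ (∀ r s, f (r • s) = φ r * f s) ∧
      (∀ n s, s ∈ sallyDegree Q I n ↔ pr n (f s) = f s) ∧
      (∀ n, ∀ c ∈ I ^ (n + 1), l n c ∈ f.range) ∧
      ∀ P : AddSubgroup K, (∀ n, ∀ c ∈ I ^ (n + 1), l n c ∈ P) → f.range ≤ P := by
  set ψ := coeffwiseHom l
  have hmem : ∀ {g}, g ∈ mulRees Q I I → ∀ n, g.coeff n ∈ I ^ (n + 1) := by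
    intro g hg n
    rw [pow_succ']
    exact (mem_mulRees_iff hQI g).mp hg n
  have hmon : ∀ n, ∀ c ∈ I ^ (n + 1), monomial n c ∈ mulRees Q I I := by
    intro n c hc
    rw [mem_mulRees_iff hQI]
    intro j
    rw [coeff_monomial]
    split_ifs with h
    · subst h; rwa [← pow_succ']
    · exact Ideal.zero_mem _
  -- The projections `pr n` recover each value `l n` from the sum ψ g, so contributions of different
  -- degrees cannot cancel.
  have hψpr : ∀ {g}, g ∈ mulRees Q I I → ∀ n, pr n (ψ g) = l n (g.coeff n) := by
    intro g hg n
    refine mulRees_induction hQI (P := fun g => pr n (ψ g) = l n (g.coeff n)) (by simp) ?_ ?_ hg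
    · intro f g hf hg
      simp [hf, hg]
    · intro m c hc
      rw [coeffwiseHom_monomial, hpr m c hc, coeff_monomial]
      by_cases h : n = m
      · subst h; simp
      · simp [h, Ne.symm h]
  -- The set of r for which this holds on all of I R(I) is closed under sums and products, so only
  -- constants, at and bt have to be tested.
  have hlin : ∀ r : Rees Q, ∀ g ∈ mulRees Q I I, ψ (r • g) = φ r * ψ g := by
    intro r
    induction r using Rees.induction hQ ha hb with
    | hC c =>
      intro g hg
      refine mulRees_induction hQI (P := fun g => ψ (algebraMap A (Rees Q) c • g) =
        φ (algebraMap A (Rees Q) c) * ψ g) (by simp) ?_ ?_ hg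
      · intro f g hf hg
        rw [smul_add, map_add, map_add, mul_add, hf, hg]
      · intro n d hd
        have : algebraMap A (Rees Q) c • monomial n d = monomial n (c * d) := by
          change C c * monomial n d = _
          rw [C_mul_monomial]
        rw [this, coeffwiseHom_monomial, coeffwiseHom_monomial, hC c n d hd]
    | hPa =>
      intro g hg
      refine mulRees_induction hQI (P := fun g => ψ (reesT Q a ha • g) =
        φ (reesT Q a ha) * ψ g) (by simp) ?_ ?_ hg
      · intro f g hf hg
        rw [smul_add, map_add, map_add, mul_add, hf, hg]
      · intro n d hd
        have : reesT Q a ha • monomial n d = monomial (n + 1) (a * d) := by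
          change monomial 1 a * monomial n d = _
          rw [monomial_mul_monomial, add_comm]
        rw [this, coeffwiseHom_monomial, coeffwiseHom_monomial, hla n d hd]
    | hPb =>
      intro g hg
      refine mulRees_induction hQI (P := fun g => ψ (reesT Q b hb • g) =
        φ (reesT Q b hb) * ψ g) (by simp) ?_ ?_ hg
      · intro f g hf hg
        rw [smul_add, map_add, map_add, mul_add, hf, hg]
      · intro n d hd
        have : reesT Q b hb • monomial n d = monomial (n + 1) (b * d) := by
          change monomial 1 b * monomial n d = _
          rw [monomial_mul_monomial, add_comm]
        rw [this, coeffwiseHom_monomial, coeffwiseHom_monomial, hlb n d hd]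
    | hadd r s hr hs =>
      intro g hg
      rw [add_smul, map_add, hr g hg, hs g hg, map_add, add_mul]
    | hmul r s hr hs =>
      intro g hg
      rw [mul_smul, hr _ (Submodule.smul_mem _ s hg), hs g hg, map_mul, mul_assoc]
  have hψker : ∀ {g}, g ∈ mulRees Q I I → (ψ g = 0 ↔ g ∈ mulRees Q I Q) := by
    intro g hg
    rw [mem_mulRees_iff le_rfl]
    constructor
    · intro h n
      rw [← hker n _ (hmem hg n), ← hψpr hg n, h, map_zero]
    · intro h
      change g.sum (fun n c => l n c) = 0
      exact Finset.sum_eq_zero fun n _ => (hker n _ (hmem hg n)).mpr (h n)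
  let _ : Module (Rees Q) K := Module.compHom K φ
  let ψ' : ↥(mulRees Q I I) →ₗ[Rees Q] K :=
    { toFun := fun g => ψ g
      map_add' := fun g h => map_add ψ _ _
      map_smul' := fun r g => hlin r g g.2 }
  have hk : (mulRees Q I Q).submoduleOf (mulRees Q I I) = LinearMap.ker ψ' := by
    ext g
    exact (hψker g.2).symm
  let F : SallyModule Q I →ₗ[Rees Q] K := Submodule.liftQ _ ψ' hk.le
  have hF : ∀ g, F (Submodule.Quotient.mk g) = ψ g.1 := fun g => rfl
  have hFi : Function.Injective F := by
    rw [← LinearMap.ker_eq_bot]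
    exact Submodule.ker_liftQ_eq_bot _ _ _ hk.ge
  refine ⟨F.toAddMonoidHom, hFi, fun r s => F.map_smul r s, ?_, ?_, ?_⟩
  · intro n s
    constructor
    · rintro ⟨g, ⟨c, hc⟩, rfl⟩
      change pr n (ψ g.1) = ψ g.1
      have hc' : monomial n c = g.1 := hc
      rw [hψpr g.2, ← hc', coeff_monomial, if_pos rfl, coeffwiseHom_monomial]
    · obtain ⟨g, rfl⟩ := Submodule.Quotient.mk_surjective _ s
      intro h
      change pr n (ψ g.1) = ψ g.1 at h
      -- The class of the degree n term of g has the same image as the class of g; injectivity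
      -- identifies them.
      refine ⟨⟨monomial n (g.1.coeff n), hmon n _ (hmem g.2 n)⟩, ⟨_, rfl⟩, hFi ?_⟩
      change ψ (monomial n _) = ψ g.1
      rw [coeffwiseHom_monomial, ← hψpr g.2, h]
  · intro n c hc
    exact ⟨Submodule.Quotient.mk ⟨monomial n c, hmon n c hc⟩, coeffwiseHom_monomial l n c⟩
  · rintro P hP _ ⟨s, rfl⟩
    obtain ⟨g, rfl⟩ := Submodule.Quotient.mk_surjective _ s
    change ψ g.1 ∈ P
    refine mulRees_induction hQI (P := fun g => ψ g ∈ P) (by simp) ?_ ?_ g.2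
    · intro f g hf hg
      rw [map_add]
      exact P.add_mem hf hg
    · intro n c hc
      rw [coeffwiseHom_monomial]
      exact hP n c hc

end SallyHom

/-! ### Arcs: analytic independence, minimality of reductions, integral closure -/

section AnalyticIndependence

variable {A k : Type*} [CommRing A] [Field k]

/-- For all `u`, `v` in an algebraic closure of `k` there is a homomorphism from `A` to power series
that reduces to `ε`, maps `I` into `(X²)` and sends `a` and `b` to `u X²` and `v X²`. -/
def HasQuadraticArcs (ε : A →+* k) (I : Ideal A) (a b : A) : Prop :=
  ∀ u v : AlgebraicClosure k, ∃ τ : A →+* PowerSeries (AlgebraicClosure k),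
    (∀ c, PowerSeries.constantCoeff (τ c) = algebraMap k _ (ε c)) ∧
    I ≤ (Ideal.span {PowerSeries.X ^ 2}).comap τ ∧
    τ a = PowerSeries.C u * PowerSeries.X ^ 2 ∧ τ b = PowerSeries.C v * PowerSeries.X ^ 2

theorem eval₂_C_mul_X_sq {E : Type*} [CommRing E] (τ : A →+* PowerSeries E) (s : Fin 2 → E)
    {n : ℕ} {F : MvPolynomial (Fin 2) A} (hF : F.IsHomogeneous n) :
    MvPolynomial.eval₂ τ (fun i => PowerSeries.C (s i) * PowerSeries.X ^ 2) F =
      MvPolynomial.eval₂ τ (fun i => PowerSeries.C (s i)) F * PowerSeries.X ^ (2 * n) := by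
  rw [MvPolynomial.eval₂_eq', MvPolynomial.eval₂_eq', Finset.sum_mul]
  refine Finset.sum_congr rfl fun d hd => ?_
  have hdn : d.degree = n := by
    rw [Finsupp.degree_eq_weight_one]
    exact hF (MvPolynomial.mem_support_iff.mp hd)
  rw [mul_assoc]
  congr 1
  simp_rw [mul_pow]
  rw [Finset.prod_mul_distrib, ← hdn, Finsupp.degree_eq_sum, Finset.mul_sum,
    Finset.prod_pow_eq_pow_sum .. |>.symm]
  simp_rw [← pow_mul]

/-- Along the arc for (u, v) the coefficient of degree 2n of F(a, b) is the residue of F evaluated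
at (u, v). It vanishes for all u, v in an infinite field, so the residue of F is zero. This is the
analytic independence of a and b. -/
theorem HasQuadraticArcs.map_eq_zero {ε : A →+* k} {I : Ideal A} {a b : A}
    (h : HasQuadraticArcs ε I a b)
    {n : ℕ} {F : MvPolynomial (Fin 2) A} (hF : F.IsHomogeneous n)
    (h0 : MvPolynomial.aeval ![a, b] F = 0) : MvPolynomial.map ε F = 0 := by
  apply MvPolynomial.map_injective (algebraMap k (AlgebraicClosure k)) (algebraMap k _).injective
  rw [map_zero]
  apply MvPolynomial.funext
  intro s
  obtain ⟨τ, hτ, -, ha, hb⟩ := h (s 0) (s 1)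
  have h1 : MvPolynomial.eval₂ τ (fun i => PowerSeries.C (s i) * PowerSeries.X ^ 2) F = 0 := by
    have := congrArg τ h0
    rw [map_zero, MvPolynomial.aeval_def, MvPolynomial.hom_eval₂] at this
    rw [← this]
    congr 1
    funext i
    fin_cases i
    · exact ha.symm
    · exact hb.symm
  rw [eval₂_C_mul_X_sq τ s hF] at h1
  have h3 := congrArg (PowerSeries.coeff (2 * n)) h1
  rw [PowerSeries.coeff_mul_X_pow', if_pos le_rfl, Nat.sub_self, map_zero,
    PowerSeries.coeff_zero_eq_constantCoeff_apply, MvPolynomial.hom_eval₂] at h3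
  rw [MvPolynomial.map_map, MvPolynomial.eval_map, map_zero, ← h3]
  congr 1
  · ext c; exact (hτ c).symm

/-- The surjection `A[U, V] → R(Q)` for `Q = (a, b)`. -/
noncomputable def reesPresentation {Q : Ideal A} {a b : A} (ha : a ∈ Q) (hb : b ∈ Q) :
    MvPolynomial (Fin 2) A →ₐ[A] Rees Q :=
  MvPolynomial.aeval ![reesT Q a ha, reesT Q b hb]

theorem reesPresentation_surjective {Q : Ideal A} {a b : A} (hQ : Q = Ideal.span {a, b})
    (ha : a ∈ Q) (hb : b ∈ Q) : Function.Surjective (reesPresentation ha hb) := by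
  intro r
  induction r using Rees.induction hQ ha hb with
  | hC c => exact ⟨MvPolynomial.C c, (reesPresentation ha hb).commutes c⟩
  | hPa => exact ⟨MvPolynomial.X 0, by simp [reesPresentation]⟩
  | hPb => exact ⟨MvPolynomial.X 1, by simp [reesPresentation]⟩
  | hadd r s hr hs =>
    obtain ⟨F, rfl⟩ := hr
    obtain ⟨G, rfl⟩ := hs
    exact ⟨F + G, map_add _ _ _⟩
  | hmul r s hr hs =>
    obtain ⟨F, rfl⟩ := hr
    obtain ⟨G, rfl⟩ := hs
    exact ⟨F * G, map_mul _ _ _⟩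

theorem coeff_reesPresentation {Q : Ideal A} {a b : A} (ha : a ∈ Q) (hb : b ∈ Q)
    (F : MvPolynomial (Fin 2) A) (n : ℕ) :
    (reesPresentation ha hb F).1.coeff n =
      MvPolynomial.aeval ![a, b] (MvPolynomial.homogeneousComponent n F) := by
  induction F using MvPolynomial.induction_on' with
  | monomial d c =>
    have h1 : (reesPresentation ha hb (MvPolynomial.monomial d c)).1 =
        monomial (d 0 + d 1) (c * (a ^ d 0 * b ^ d 1)) := by
      rw [reesPresentation, MvPolynomial.aeval_monomial, Finsupp.prod_fintype _ _ (by simp),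
        Fin.prod_univ_two]
      change C c * ((monomial 1 a) ^ d 0 * (monomial 1 b) ^ d 1) = _
      simp [monomial_pow, monomial_mul_monomial, C_mul_monomial]
    rw [h1, coeff_monomial]
    have hdeg : d.degree = d 0 + d 1 := by rw [Finsupp.degree_eq_sum, Fin.sum_univ_two]
    have h2 := MvPolynomial.isHomogeneous_monomial c hdeg
    rw [MvPolynomial.homogeneousComponent_of_mem h2]
    by_cases h : d 0 + d 1 = n
    · subst h
      rw [if_pos rfl, if_pos rfl, MvPolynomial.aeval_monomial, Finsupp.prod_fintype _ _ (by simp),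
        Fin.prod_univ_two]
      rfl
    · rw [if_neg h, if_neg (Ne.symm h), map_zero]
  | add F G hF hG =>
    rw [map_add, map_add, map_add, ← hF, ← hG]
    exact coeff_add _ _ _

/-- If `Q = (a, b)` has quadratic arcs, its fiber cone is a polynomial ring in two variables. -/
theorem HasQuadraticArcs.exists_fiberConeHom [IsLocalRing A] {ε : A →+* k}
    (hε : Function.Surjective ε)
    (hker : RingHom.ker ε = IsLocalRing.maximalIdeal A) {Q I : Ideal A} {a b : A}
    (hQ : Q = Ideal.span {a, b}) (ha : a ∈ Q) (hb : b ∈ Q) (h : HasQuadraticArcs ε I a b) :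
    ∃ φ : Rees Q →+* MvPolynomial (Fin 2) k, Function.Surjective φ ∧
      RingHom.ker φ = fiberIdeal Q ∧
      (∀ c, φ (algebraMap A (Rees Q) c) = MvPolynomial.C (ε c)) ∧
      φ (reesT Q a ha) = MvPolynomial.X 0 ∧ φ (reesT Q b hb) = MvPolynomial.X 1 ∧
      (∀ n, ∀ r ∈ reesDegree Q n, (φ r).IsHomogeneous n) ∧
      ∀ n, ∀ G : MvPolynomial (Fin 2) k, G.IsHomogeneous n → ∃ r ∈ reesDegree Q n, φ r = G := by
  set θ := reesPresentation ha hb with hθ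
  have hθs : Function.Surjective θ.toRingHom := reesPresentation_surjective hQ ha hb
  -- The homogeneous components of a relation among at and bt are themselves relations F(a, b) = 0,
  -- so analytic independence puts all coefficients of the relation into the kernel of ε.
  have hle : RingHom.ker θ.toRingHom ≤ RingHom.ker (MvPolynomial.map (σ := Fin 2) ε) := by
    intro F hF
    have hF0 : θ F = 0 := hF
    rw [RingHom.mem_ker, ← MvPolynomial.sum_homogeneousComponent F, map_sum]
    refine Finset.sum_eq_zero fun n _ => h.map_eq_zero
      (MvPolynomial.homogeneousComponent_isHomogeneous n F) ?_
    rw [← coeff_reesPresentation ha hb, ← hθ, hF0]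
    exact coeff_zero n
  let φ : Rees Q →+* MvPolynomial (Fin 2) k :=
    RingHom.liftOfSurjective θ.toRingHom hθs ⟨MvPolynomial.map ε, hle⟩
  have hφ : ∀ F, φ (θ F) = MvPolynomial.map ε F := fun F =>
    RingHom.liftOfRightInverse_comp_apply θ.toRingHom _ (Function.rightInverse_surjInv hθs)
      ⟨MvPolynomial.map ε, hle⟩ F
  have hmap := MvPolynomial.map_surjective (σ := Fin 2) ε hε
  have hcoeff : ∀ F n j, (θ (MvPolynomial.homogeneousComponent n F)).1.coeff j =
      if j = n then (θ F).1.coeff n else 0 := by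
    intro F n j
    rw [hθ, coeff_reesPresentation, coeff_reesPresentation,
      MvPolynomial.homogeneousComponent_of_mem
        (MvPolynomial.homogeneousComponent_isHomogeneous n F)]
    split_ifs <;> simp
  have hdeg : ∀ F n, θ (MvPolynomial.homogeneousComponent n F) ∈ reesDegree Q n := by
    intro F n
    refine ⟨(θ F).1.coeff n, ?_⟩
    refine Polynomial.ext fun j => ?_
    refine Eq.trans ?_ (hcoeff F n j).symm
    rw [coeff_monomial]
    simp only [eq_comm]
  refine ⟨φ, ?_, ?_, ?_, ?_, ?_, ?_, ?_⟩
  · intro G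
    obtain ⟨F, rfl⟩ := hmap G
    exact ⟨θ F, hφ F⟩
  · apply le_antisymm
    -- An element of the kernel lifts to a polynomial with all coefficients in the maximal ideal,
    -- and such a polynomial maps into the fiber ideal.
    · intro r hr
      obtain ⟨F, rfl⟩ := hθs r
      have hF : F ∈ RingHom.ker (MvPolynomial.map (σ := Fin 2) ε) := by
        rw [RingHom.mem_ker, ← hφ]; exact hr
      rw [MvPolynomial.ker_map, hker] at hF
      have := Ideal.mem_map_of_mem θ.toRingHom hF
      have hθC : θ.toRingHom.comp MvPolynomial.C = algebraMap A (Rees Q) :=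
        RingHom.ext fun c => θ.commutes c
      rwa [Ideal.map_map, hθC] at this
    · rw [fiberIdeal, Ideal.map_le_iff_le_comap]
      intro c hc
      rw [← hker, RingHom.mem_ker] at hc
      rw [Ideal.mem_comap, RingHom.mem_ker, ← θ.commutes c, hφ, MvPolynomial.algebraMap_eq,
        MvPolynomial.map_C, hc, map_zero]
  · intro c
    rw [← θ.commutes c, hφ, MvPolynomial.algebraMap_eq, MvPolynomial.map_C]
  · have : θ (MvPolynomial.X 0) = reesT Q a ha := by simp [hθ, reesPresentation]
    rw [← this, hφ, MvPolynomial.map_X]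
  · have : θ (MvPolynomial.X 1) = reesT Q b hb := by simp [hθ, reesPresentation]
    rw [← this, hφ, MvPolynomial.map_X]
  · rintro n r ⟨c, hc⟩
    obtain ⟨F, rfl⟩ := hθs r
    have hc' : monomial n c = (θ F).1 := hc
    have : θ F = θ (MvPolynomial.homogeneousComponent n F) := by
      refine Subtype.ext (Polynomial.ext fun j => ?_)
      rw [hcoeff, ← hc', coeff_monomial, coeff_monomial, if_pos rfl]
      simp only [eq_comm]
    change (φ (θ F)).IsHomogeneous n
    rw [this, hφ]
    exact (MvPolynomial.homogeneousComponent_isHomogeneous n F).map ε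
  · intro n G hG
    obtain ⟨F, rfl⟩ := hmap G
    refine ⟨_, hdeg F n, ?_⟩
    rw [hφ]
    have hGn := MvPolynomial.homogeneousComponent_of_mem (m := n) hG
    rw [if_pos rfl] at hGn
    conv_rhs => rw [← hGn]
    ext d
    simp only [MvPolynomial.coeff_map, MvPolynomial.coeff_homogeneousComponent]
    split_ifs <;> simp

/-- If K ⊆ Q does not span Q/𝔪Q, a nonzero functional (u, v) kills its image. Along the arc for (u,
v), K has order at least 3, so I^(n+1) = K Iⁿ has order at least 2n + 3; but a^(n+1) and b^(n+1) map
to u^(n+1) and v^(n+1) times the power of exponent 2n + 2, forcing u = v = 0. -/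
theorem HasQuadraticArcs.isMinimalIdealReduction [IsLocalRing A] {ε : A →+* k}
    (hε : Function.Surjective ε) (hker : RingHom.ker ε = IsLocalRing.maximalIdeal A)
    {Q I : Ideal A} {a b : A} (hQ : Q = Ideal.span {a, b}) (h : HasQuadraticArcs ε I a b)
    (hred : IsIdealReduction Q I) : IsMinimalIdealReduction Q I := by
  refine ⟨hred, fun K ⟨hKI, n, hn⟩ hKQ => le_antisymm hKQ ?_⟩
  have ha : a ∈ Q := by rw [hQ]; exact Ideal.subset_span (Or.inl rfl)
  have hb : b ∈ Q := by rw [hQ]; exact Ideal.subset_span (Or.inr rfl)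
  have hfg : Q.FG := by rw [hQ]; exact Submodule.fg_span (by simp)
  refine Submodule.le_of_le_smul_of_le_jacobson_bot (I := IsLocalRing.maximalIdeal A) hfg
    (IsLocalRing.maximalIdeal_le_jacobson _) ?_
  -- W collects the residues of the coefficient pairs of elements of K. When W is everything, K
  -- contains a and b up to 𝔪Q and Nakayama's lemma applies.
  let W : Submodule k (k × k) :=
    { carrier := {s | ∃ α β : A, α * a + β * b ∈ K ∧ ε α = s.1 ∧ ε β = s.2}
      zero_mem' := ⟨0, 0, by simp, by simp, by simp⟩
      add_mem' := by
        rintro s t ⟨α, β, h1, h2, h3⟩ ⟨α', β', h1', h2', h3'⟩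
        refine ⟨α + α', β + β', ?_, by simp [h2, h2'], by simp [h3, h3']⟩
        convert K.add_mem h1 h1' using 1
        ring
      smul_mem' := by
        rintro c s ⟨α, β, h1, h2, h3⟩
        obtain ⟨c, rfl⟩ := hε c
        refine ⟨c * α, c * β, ?_, by simp [h2], by simp [h3]⟩
        convert K.mul_mem_left c h1 using 1
        ring }
  by_cases hW : W = ⊤
  · have key : ∀ c ∈ Q, ∀ α β : A, α * a + β * b ∈ K →
        c - (α * a + β * b) ∈ IsLocalRing.maximalIdeal A • Q →
        c ∈ K ⊔ IsLocalRing.maximalIdeal A • Q := by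
      intro c _ α β h1 h2
      have := Submodule.add_mem_sup h1 h2
      rwa [add_sub_cancel] at this
    have hm : ∀ {α}, ε α = 0 → α ∈ IsLocalRing.maximalIdeal A := fun h => by
      rw [← hker]; exact h
    conv_lhs => rw [hQ]
    rw [Ideal.span_le]
    rintro _ (rfl | rfl)
    · obtain ⟨α, β, h1, h2, h3⟩ : ((1, 0) : k × k) ∈ W := hW ▸ Submodule.mem_top
      refine key _ ha α β h1 ?_
      rw [show ∀ c, c - (α * c + β * b) = (1 - α) * c + (-β) * b from fun c => by ring]
      refine Ideal.add_mem _ (Ideal.mul_mem_mul (hm ?_) ha) (Ideal.mul_mem_mul (hm ?_) hb)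
      · simp [h2]
      · simp [h3]
    · obtain ⟨α, β, h1, h2, h3⟩ : ((0, 1) : k × k) ∈ W := hW ▸ Submodule.mem_top
      refine key _ hb α β h1 ?_
      rw [show ∀ c, c - (α * a + β * c) = (-α) * a + (1 - β) * c from fun c => by ring]
      refine Ideal.add_mem _ (Ideal.mul_mem_mul (hm ?_) ha) (Ideal.mul_mem_mul (hm ?_) hb)
      · simp [h2]
      · simp [h3]
  · exfalso
    obtain ⟨f, hf0, hf⟩ := Submodule.exists_le_ker_of_lt_top W (lt_top_iff_ne_top.mpr hW)
    have hfs : ∀ s : k × k, f s = s.1 * f (1, 0) + s.2 * f (0, 1) := by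
      intro s
      conv_lhs => rw [show s = s.1 • ((1, 0) : k × k) + s.2 • (0, 1) by ext <;> simp]
      rw [map_add, map_smul, map_smul, smul_eq_mul, smul_eq_mul]
    set u := f (1, 0)
    set v := f (0, 1)
    obtain ⟨τ, hτ, hI, hτa, hτb⟩ := h (algebraMap k _ u) (algebraMap k _ v)
    have hKτ : K ≤ (Ideal.span {PowerSeries.X ^ 3}).comap τ := by
      intro g hg
      obtain ⟨α, β, rfl⟩ := Ideal.mem_span_pair.mp (hQ ▸ hKQ hg)
      have h0 : ε α * u + ε β * v = 0 := by
        rw [← hfs (ε α, ε β)]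
        exact hf ⟨α, β, hg, rfl, rfl⟩
      rw [Ideal.mem_comap, Ideal.mem_span_singleton, map_add, map_mul, map_mul, hτa, hτb,
        ← mul_assoc, ← mul_assoc, ← add_mul, pow_succ, mul_comm _ (PowerSeries.X ^ 2)]
      refine mul_dvd_mul_left _ ?_
      rw [PowerSeries.X_dvd_iff, map_add, map_mul, map_mul, hτ, hτ]
      simp only [PowerSeries.constantCoeff_C]
      rw [← map_mul, ← map_mul, ← map_add, h0, map_zero]
    have hIn : I ^ (n + 1) ≤ (Ideal.span {PowerSeries.X ^ (2 * n + 3)}).comap τ := by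
      rw [hn, Ideal.mul_le]
      intro r hr s hs
      have h1 := Ideal.mem_span_singleton.mp (hKτ hr)
      have h2 : τ s ∈ Ideal.span {(PowerSeries.X ^ 2 : PowerSeries (AlgebraicClosure k))} ^ n :=
        (Ideal.map_le_iff_le_comap.mp (by
          rw [Ideal.map_pow]
          exact Ideal.pow_right_mono (Ideal.map_le_iff_le_comap.mpr hI) n)) hs
      rw [Ideal.span_singleton_pow, Ideal.mem_span_singleton, ← pow_mul] at h2
      rw [Ideal.mem_comap, Ideal.mem_span_singleton, map_mul, add_comm, pow_add]
      exact mul_dvd_mul h1 h2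
    have key : ∀ c ∈ I, ∀ u : k, τ c = PowerSeries.C (algebraMap k (AlgebraicClosure k) u) *
        PowerSeries.X ^ 2 → u = 0 := by
      intro c hc u hu
      have h1 := Ideal.mem_span_singleton.mp (hIn (Ideal.pow_mem_pow hc (n + 1)))
      rw [map_pow, hu, mul_pow, ← pow_mul, ← map_pow, ← map_pow, PowerSeries.X_pow_dvd_iff] at h1
      have h2 := h1 (2 * (n + 1)) (by omega)
      rw [PowerSeries.coeff_C_mul, PowerSeries.coeff_X_pow_self, mul_one, _root_.map_eq_zero] at h2
      exact pow_eq_zero_iff (by omega) |>.mp h2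
    have hu := key a (hred.1 ha) u hτa
    have hv := key b (hred.1 hb) v hτb
    apply hf0
    ext <;> simp [hfs, hu, hv]

/-- A homomorphism to power series over a domain that maps `I` into `(X²)` also maps the integral
closure of `I` into `(X²)`. -/
theorem X_sq_dvd_of_mem_idealIntegralClosure {F : Type*} [CommRing F] [IsDomain F] {I : Ideal A}
    {τ : A →+* PowerSeries F} (hI : I ≤ (Ideal.span {PowerSeries.X ^ 2}).comap τ) {r : A}
    (hr : r ∈ idealIntegralClosure I) : PowerSeries.X ^ 2 ∣ τ r := by
  obtain ⟨n, hn, a, ha, h0⟩ := hr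
  have hX : ∀ i, (PowerSeries.X ^ (2 * i) : PowerSeries F) ∣ τ (a i) := by
    intro i
    have h2 : τ (a i) ∈ Ideal.span {(PowerSeries.X ^ 2 : PowerSeries F)} ^ i :=
      (Ideal.map_le_iff_le_comap.mp (by
        rw [Ideal.map_pow]
        exact Ideal.pow_right_mono (Ideal.map_le_iff_le_comap.mpr hI) i)) (ha i)
    rwa [Ideal.span_singleton_pow, Ideal.mem_span_singleton, ← pow_mul] at h2
  -- If τ r has order at least e ≤ 1, the term aᵢ r^(n-i) has order at least 2i + e(n-i) ≥ en + 1,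
  -- since i ≥ 1. Hence so has rⁿ, and since the power series variable is prime the order of τ r is
  -- at least e + 1. Two such steps suffice.
  have step : ∀ e < 2, PowerSeries.X ^ e ∣ τ r → PowerSeries.X ^ (e + 1) ∣ τ r := by
    rintro e he ⟨U, hU⟩
    have h1 : (PowerSeries.X ^ (e * n + 1) : PowerSeries F) ∣ τ r ^ n := by
      have h2 := congrArg τ h0
      rw [map_zero, map_add, map_pow, map_sum] at h2
      rw [eq_neg_of_add_eq_zero_left h2, dvd_neg]
      refine Finset.dvd_sum fun i hi => ?_
      rw [Finset.mem_Icc] at hi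
      obtain ⟨j, rfl⟩ := Nat.exists_eq_add_of_le hi.2
      rw [map_mul, map_pow, hU, Nat.add_sub_cancel_left, mul_pow, ← pow_mul, ← mul_assoc]
      refine Dvd.dvd.mul_right ((pow_dvd_pow _ ?_).trans
        ((pow_add _ (2 * i) (e * j)).dvd.trans (mul_dvd_mul_right (hX i) _))) _
      nlinarith
    rw [hU, mul_pow, ← pow_mul, pow_succ] at h1
    have h3 := (mul_dvd_mul_iff_left (pow_ne_zero _ PowerSeries.X_ne_zero)).mp h1
    rw [hU, pow_succ]
    exact mul_dvd_mul_left _ (PowerSeries.X_prime.dvd_of_dvd_pow h3)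
  exact step 1 (by norm_num) (step 0 (by norm_num) (by simp))

end AnalyticIndependence

/-! ### Monomial ideals in power series rings -/

section MonomialSupport

variable {σ R : Type*} [CommRing R]

/-- Finiteness of G is essential: the terms divisible by one generator g are split off as a single
multiple of that monomial, and the rest is treated by induction. -/
theorem MvPowerSeries.mem_span_of_support [DecidableEq (σ →₀ ℕ)] (G : Finset (σ →₀ ℕ))
    (f : MvPowerSeries σ R) (h : ∀ e, MvPowerSeries.coeff e f ≠ 0 → ∃ g ∈ G, g ≤ e) :
    f ∈ Ideal.span ((fun g => MvPowerSeries.monomial g (1 : R)) '' (G : Set (σ →₀ ℕ))) := by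
  classical
  induction G using Finset.induction_on generalizing f with
  | empty =>
    have : f = 0 := by
      ext e
      by_contra he
      obtain ⟨g, hg, -⟩ := h e he
      simp at hg
    simp [this]
  | insert g G _ ih =>
    let f1 : MvPowerSeries σ R := MvPowerSeries.monomial g 1 *
      (show MvPowerSeries σ R from fun e => MvPowerSeries.coeff (e + g) f)
    have hf1 : ∀ e, MvPowerSeries.coeff e f1 = if g ≤ e then MvPowerSeries.coeff e f else 0 := by
      intro e
      rw [MvPowerSeries.coeff_monomial_mul]
      split_ifs with hge
      · rw [one_mul]
        change MvPowerSeries.coeff (e - g + g) f = _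
        rw [tsub_add_cancel_of_le hge]
      · rfl
    rw [← sub_add_cancel f f1]
    refine Ideal.add_mem _ (Ideal.span_mono (Set.image_mono (by simp)) (ih (f - f1) ?_)) ?_
    · intro e he
      rw [map_sub, hf1] at he
      split_ifs at he with hge
      · simp at he
      · rw [sub_zero] at he
        obtain ⟨g', hg', hle⟩ := h e he
        rcases Finset.mem_insert.mp hg' with rfl | hg'
        · exact absurd hle hge
        · exact ⟨g', hg', hle⟩
    · exact Ideal.mul_mem_right _ _ (Ideal.subset_span ⟨g, by simp, rfl⟩)

theorem MvPowerSeries.ker_constantCoeff [Finite σ] :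
    RingHom.ker (MvPowerSeries.constantCoeff (σ := σ) (R := R)) =
      Ideal.span (Set.range MvPowerSeries.X) := by
  classical
  cases nonempty_fintype σ
  apply le_antisymm
  · intro f hf
    have := MvPowerSeries.mem_span_of_support
      (Finset.univ.image fun i : σ => Finsupp.single i 1) f ?_
    · refine Ideal.span_mono ?_ this
      rintro _ ⟨g, hg, rfl⟩
      obtain ⟨i, -, rfl⟩ := Finset.mem_image.mp hg
      exact ⟨i, rfl⟩
    · intro e he
      have : e ≠ 0 := by
        rintro rfl
        exact he hf
      obtain ⟨i, hi⟩ := Finsupp.ne_iff.mp this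
      refine ⟨_, Finset.mem_image_of_mem _ (Finset.mem_univ i), ?_⟩
      rw [Finsupp.single_le_iff]
      exact Nat.one_le_iff_ne_zero.mpr hi
  · rw [Ideal.span_le]
    rintro _ ⟨i, rfl⟩
    simp [RingHom.mem_ker]

end MonomialSupport

/-! ### The ring A, its arcs, and the integral closure of ideals inside I -/

namespace SallyExample

variable (k : Type*) [Field k]

/-- The residue map `A → k`, given by the constant coefficient. -/
noncomputable def residue : ExRing k →+* k :=
  Ideal.Quotient.lift (relations k) MvPowerSeries.constantCoeff fun f hf => by
    have h := hf.2
    have h1 : Ideal.span {MvPowerSeries.X 2, MvPowerSeries.X 3} ≤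
        RingHom.ker (MvPowerSeries.constantCoeff (σ := Fin 4) (R := k)) := by
      rw [Ideal.span_le]
      rintro _ (rfl | rfl) <;> simp [RingHom.mem_ker]
    exact h1 h

theorem residue_toExRing (f : MvPowerSeries (Fin 4) k) :
    residue k (toExRing k f) = MvPowerSeries.constantCoeff f := rfl

theorem toExRing_surjective : Function.Surjective (toExRing k) := Ideal.Quotient.mk_surjective

theorem residue_surjective : Function.Surjective (residue k) := fun c =>
  ⟨toExRing k (MvPowerSeries.C c), by rw [residue_toExRing, MvPowerSeries.constantCoeff_C]⟩

theorem ker_residue : RingHom.ker (residue k) = IsLocalRing.maximalIdeal (ExRing k) :=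
  IsLocalRing.eq_maximalIdeal (RingHom.ker_isMaximal_of_surjective _ (residue_surjective k))

theorem maximalIdeal_eq : IsLocalRing.maximalIdeal (ExRing k) =
    Ideal.span {x k, y k} ⊔ Ideal.span {z k, w k} := by
  have h : IsLocalRing.maximalIdeal (ExRing k) =
      (RingHom.ker (MvPowerSeries.constantCoeff (σ := Fin 4) (R := k))).map (toExRing k) := by
    rw [← ker_residue]
    apply le_antisymm
    · intro r hr
      obtain ⟨f, rfl⟩ := toExRing_surjective k r
      exact Ideal.mem_map_of_mem _ hr
    · rw [Ideal.map_le_iff_le_comap]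
      exact fun f hf => hf
  rw [h, MvPowerSeries.ker_constantCoeff, Ideal.map_span, ← Ideal.span_union]
  congr 1
  ext r
  simp only [Set.mem_image, Set.mem_range, Fin.exists_fin_succ]
  simp only [x, y, z, w, Set.mem_union, Set.mem_insert_iff, Set.mem_singleton_iff]
  simp [eq_comm, or_assoc]

theorem _root_.Ideal.sup_mul_sup_sup {R : Type*} [CommRing R] (P N : Ideal R) :
    (P ⊔ N) * (P ⊔ N) ⊔ N = P * P ⊔ N := by
  have h1 : P * N ≤ N := Ideal.mul_le_right
  have h2 : N * (P ⊔ N) ≤ N := Ideal.mul_le_left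
  have h3 : P * P ≤ (P ⊔ N) * (P ⊔ N) := Ideal.mul_mono le_sup_left le_sup_left
  apply le_antisymm
  · refine sup_le ?_ le_sup_right
    rw [Ideal.sup_mul, Ideal.mul_sup]
    exact sup_le (sup_le le_sup_left (le_trans h1 le_sup_right)) (le_trans h2 le_sup_right)
  · exact sup_le (le_trans h3 le_sup_left) le_sup_right

theorem I_eq : I k = Ideal.span {x k * x k, x k * y k, y k * x k, y k * y k} ⊔
    Ideal.span {z k, w k} := by
  rw [I, maximalIdeal_eq, pow_two, Ideal.sup_mul_sup_sup, Ideal.span_pair_mul_span_pair]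

theorem I_le_of_mem {J : Ideal (ExRing k)} (hx : x k * x k ∈ J) (hxy : x k * y k ∈ J)
    (hy : y k * y k ∈ J) (hz : z k ∈ J) (hw : w k ∈ J) : I k ≤ J := by
  rw [I_eq]
  refine sup_le ?_ ?_ <;> rw [Ideal.span_le]
  · rintro _ (rfl | rfl | rfl | rfl)
    · exact hx
    · exact hxy
    · exact mul_comm (x k) (y k) ▸ hxy
    · exact hy
  · rintro _ (rfl | rfl)
    · exact hz
    · exact hw

theorem xx_mem : x k * x k ∈ I k := by
  rw [I_eq]; exact Ideal.mem_sup_left (Ideal.subset_span (by simp))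

theorem xy_mem : x k * y k ∈ I k := by
  rw [I_eq]; exact Ideal.mem_sup_left (Ideal.subset_span (by simp))

theorem yy_mem : y k * y k ∈ I k := by
  rw [I_eq]; exact Ideal.mem_sup_left (Ideal.subset_span (by simp))

theorem z_mem : z k ∈ I k := Ideal.mem_sup_right (Ideal.subset_span (by simp))

theorem w_mem : w k ∈ I k := Ideal.mem_sup_right (Ideal.subset_span (by simp))

theorem I_fg : (I k).FG := by
  rw [I_eq]
  exact Submodule.FG.sup (Submodule.fg_span (Set.toFinite _)) (Submodule.fg_span (Set.toFinite _))

theorem toExRing_eq_zero_of_mem {f g : MvPowerSeries (Fin 4) k}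
    (hf : f ∈ Ideal.span {MvPowerSeries.X 0 ^ 2, MvPowerSeries.X 1 ^ 2})
    (hg : g ∈ Ideal.span {MvPowerSeries.X 2, MvPowerSeries.X 3}) : toExRing k (f * g) = 0 :=
  Ideal.Quotient.eq_zero_iff_mem.mpr
    ⟨Ideal.mul_mem_right _ _ hf, Ideal.mul_mem_left _ _ hg⟩

theorem xxz : x k ^ 2 * z k = 0 := by
  have h := toExRing_eq_zero_of_mem k (Ideal.subset_span (Or.inl rfl))
    (Ideal.subset_span (Or.inl rfl))
  rwa [map_mul, map_pow] at h

theorem xxw : x k ^ 2 * w k = 0 := by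
  have h := toExRing_eq_zero_of_mem k (Ideal.subset_span (Or.inl rfl))
    (Ideal.subset_span (Or.inr rfl))
  rwa [map_mul, map_pow] at h

theorem yyz : y k ^ 2 * z k = 0 := by
  have h := toExRing_eq_zero_of_mem k (Ideal.subset_span (Or.inr rfl))
    (Ideal.subset_span (Or.inl rfl))
  rwa [map_mul, map_pow] at h

theorem yyw : y k ^ 2 * w k = 0 := by
  have h := toExRing_eq_zero_of_mem k (Ideal.subset_span (Or.inr rfl))
    (Ideal.subset_span (Or.inr rfl))
  rwa [map_mul, map_pow] at h

/-- Homomorphisms from `A` to power series in one variable that give `x`, `y` weight `1` and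
`z`, `w` weight `2`. -/
theorem exists_arc {E : Type*} [CommRing E] [Algebra k E] (p q r t : E)
    (h : (r = 0 ∧ t = 0) ∨ (p ^ 2 = 0 ∧ q ^ 2 = 0)) :
    ∃ ρ : ExRing k →+* PowerSeries E, ρ (x k) = PowerSeries.C p * PowerSeries.X ∧
      ρ (y k) = PowerSeries.C q * PowerSeries.X ∧ ρ (z k) = PowerSeries.C r * PowerSeries.X ^ 2 ∧
      ρ (w k) = PowerSeries.C t * PowerSeries.X ^ 2 ∧
      ∀ c, PowerSeries.constantCoeff (ρ c) = algebraMap k E (residue k c) := by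
  let s : Fin 4 → MvPowerSeries Unit E := ![PowerSeries.C p * PowerSeries.X,
    PowerSeries.C q * PowerSeries.X, PowerSeries.C r * PowerSeries.X ^ 2,
    PowerSeries.C t * PowerSeries.X ^ 2]
  have hs0 : ∀ i, PowerSeries.constantCoeff (s i) = 0 := by
    intro i
    fin_cases i <;> simp [s]
  have hs : MvPowerSeries.HasSubst s := MvPowerSeries.hasSubst_of_constantCoeff_zero hs0
  let ρ : MvPowerSeries (Fin 4) k →ₐ[k] PowerSeries E := MvPowerSeries.substAlgHom hs
  have hρ : ∀ i, ρ (MvPowerSeries.X i) = s i := MvPowerSeries.substAlgHom_X hs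
  -- It is enough to kill one of the two intersected ideals: r = t = 0 kills (Z, W), and p² = q² = 0
  -- kills (X², Y²).
  have hker : ∀ f ∈ relations k, ρ f = 0 := by
    rintro f ⟨h1, h2⟩
    rcases h with ⟨hr, ht⟩ | ⟨hp, hq⟩
    · have : Ideal.span {MvPowerSeries.X 2, MvPowerSeries.X 3} ≤ RingHom.ker ρ := by
        rw [Ideal.span_le]
        rintro _ (rfl | rfl)
        · change ρ _ = 0
          rw [hρ]; simp [s, hr]
        · change ρ _ = 0
          rw [hρ]; simp [s, ht]
      exact this h2
    · have : Ideal.span {MvPowerSeries.X 0 ^ 2, MvPowerSeries.X 1 ^ 2} ≤ RingHom.ker ρ := by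
        rw [Ideal.span_le]
        rintro _ (rfl | rfl)
        · change ρ _ = 0
          rw [map_pow, hρ]
          simp [s, mul_pow, ← map_pow, hp]
        · change ρ _ = 0
          rw [map_pow, hρ]
          simp [s, mul_pow, ← map_pow, hq]
      exact this h1
  refine ⟨Ideal.Quotient.lift (relations k) ρ.toRingHom hker, hρ 0, hρ 1, hρ 2, hρ 3, ?_⟩
  intro c
  obtain ⟨f, rfl⟩ := toExRing_surjective k c
  change PowerSeries.constantCoeff (ρ f) = algebraMap k E (MvPowerSeries.constantCoeff f)
  -- The variables go to series without constant term, so the constant coefficient of the image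
  -- depends only on that of f.
  have h1 : f - MvPowerSeries.C (MvPowerSeries.constantCoeff f) ∈
      Ideal.span (Set.range MvPowerSeries.X) := by
    rw [← MvPowerSeries.ker_constantCoeff]
    simp [RingHom.mem_ker]
  have h2 : Ideal.span (Set.range MvPowerSeries.X) ≤
      RingHom.ker (PowerSeries.constantCoeff.comp ρ.toRingHom) := by
    rw [Ideal.span_le]
    rintro _ ⟨i, rfl⟩
    change PowerSeries.constantCoeff (ρ _) = 0
    rw [hρ, hs0]
  have h3 : PowerSeries.constantCoeff (ρ (f - MvPowerSeries.C (MvPowerSeries.constantCoeff f))) =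
    0 := h2 h1
  rw [map_sub, map_sub, sub_eq_zero] at h3
  rw [h3]
  have h4 : ρ (MvPowerSeries.C (MvPowerSeries.constantCoeff f)) =
    algebraMap k (PowerSeries E) (MvPowerSeries.constantCoeff f) := ρ.commutes _
  rw [h4]
  rfl

/-- The arcs of `exists_arc` map `I` into `(X²)`. -/
theorem I_le_comap {E : Type*} [CommRing E] {ρ : ExRing k →+* PowerSeries E} {p q r t : E}
    (hx : ρ (x k) = PowerSeries.C p * PowerSeries.X)
    (hy : ρ (y k) = PowerSeries.C q * PowerSeries.X)
    (hz : ρ (z k) = PowerSeries.C r * PowerSeries.X ^ 2)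
    (hw : ρ (w k) = PowerSeries.C t * PowerSeries.X ^ 2) :
    I k ≤ (Ideal.span {PowerSeries.X ^ 2}).comap ρ := by
  apply I_le_of_mem <;> rw [Ideal.mem_comap, Ideal.mem_span_singleton]
  · rw [map_mul, hx]
    exact ⟨PowerSeries.C p * PowerSeries.C p, by ring⟩
  · rw [map_mul, hx, hy]
    exact ⟨PowerSeries.C p * PowerSeries.C q, by ring⟩
  · rw [map_mul, hy]
    exact ⟨PowerSeries.C q * PowerSeries.C q, by ring⟩
  · rw [hz]; exact dvd_mul_left _ _
  · rw [hw]; exact dvd_mul_left _ _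

theorem hasQuadraticArcs_Q :
    HasQuadraticArcs (residue k) (I k) (z k - x k ^ 2) (w k - y k ^ 2) := by
  intro u v
  obtain ⟨p, hp⟩ := IsAlgClosed.exists_pow_nat_eq (-u) (n := 2) (by norm_num)
  obtain ⟨q, hq⟩ := IsAlgClosed.exists_pow_nat_eq (-v) (n := 2) (by norm_num)
  obtain ⟨ρ, hx, hy, hz, hw, hc⟩ := exists_arc k p q 0 0 (Or.inl ⟨rfl, rfl⟩)
  refine ⟨ρ, hc, I_le_comap k hx hy hz hw, ?_, ?_⟩
  · rw [map_sub, map_pow, hx, hz, mul_pow, ← map_pow, hp]; simp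
  · rw [map_sub, map_pow, hy, hw, mul_pow, ← map_pow, hq]; simp

theorem hasQuadraticArcs_Q' :
    HasQuadraticArcs (residue k) (I k) (z k - x k * y k) (x k ^ 2 + y k ^ 2 - w k) := by
  intro u v
  -- With z = w = 0 the generators become -pq and p² + q². For u ≠ 0, substituting q = -u/p turns
  -- the second equation into the quartic p⁴ - v p² + u² = 0.
  obtain ⟨p, q, hu, hv⟩ : ∃ p q : AlgebraicClosure k, p * q = -u ∧ p ^ 2 + q ^ 2 = v := by
    by_cases hu : u = 0
    · obtain ⟨q, hq⟩ := IsAlgClosed.exists_pow_nat_eq v (n := 2) (by norm_num)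
      exact ⟨0, q, by simp [hu], by simp [hq]⟩
    · obtain ⟨p, hp⟩ := IsAlgClosed.exists_root
        (X ^ 4 - C v * X ^ 2 + C (u ^ 2) : (AlgebraicClosure k)[X]) (by
          have : (X ^ 4 - C v * X ^ 2 + C (u ^ 2) : (AlgebraicClosure k)[X]).degree = 4 := by
            compute_degree!
          rw [this]; norm_num)
      have hp' : p ^ 4 - v * p ^ 2 + u ^ 2 = 0 := by simpa using hp
      have hp0 : p ≠ 0 := by
        rintro rfl
        exact hu (by simpa using hp')
      refine ⟨p, -u / p, by field_simp, ?_⟩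
      field_simp
      linear_combination hp'
  obtain ⟨ρ, hx, hy, hz, hw, hc⟩ := exists_arc k p q 0 0 (Or.inl ⟨rfl, rfl⟩)
  refine ⟨ρ, hc, I_le_comap k hx hy hz hw, ?_, ?_⟩
  · rw [map_sub, map_mul, hx, hy, hz, ← neg_eq_iff_eq_neg.mpr hu, map_neg, map_mul, map_zero]
    ring
  · rw [map_sub, map_add, map_pow, map_pow, hx, hy, hw, ← hv, map_add, map_pow, map_pow, map_zero]
    ring

/-- Along arcs with z = w = 0 the element r has order at least 2. Order zero puts r into the maximal
ideal; writing r = cx + dy modulo (z, w), order one gives c(0)p + d(0)q = 0 for all p, q, so c and d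
are non-units and r lies in 𝔪² + (z, w). -/
theorem mem_I_of_mem_idealIntegralClosure {J : Ideal (ExRing k)} (hJ : J ≤ I k) {r : ExRing k}
    (hr : r ∈ idealIntegralClosure J) : r ∈ I k := by
  have harc : ∀ p q : k, ∃ ρ : ExRing k →+* PowerSeries k,
      ρ (x k) = PowerSeries.C p * PowerSeries.X ∧ ρ (y k) = PowerSeries.C q * PowerSeries.X ∧
      ρ (z k) = 0 ∧ ρ (w k) = 0 ∧ (∀ c, PowerSeries.constantCoeff (ρ c) = residue k c) ∧
      PowerSeries.X ^ 2 ∣ ρ r := by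
    intro p q
    obtain ⟨ρ, hx, hy, hz, hw, hc⟩ := exists_arc k p q 0 0 (Or.inl ⟨rfl, rfl⟩)
    exact ⟨ρ, hx, hy, by simp [hz], by simp [hw], hc,
      X_sq_dvd_of_mem_idealIntegralClosure (hJ.trans (I_le_comap k hx hy hz hw)) hr⟩
  have hrm : r ∈ IsLocalRing.maximalIdeal (ExRing k) := by
    obtain ⟨ρ, -, -, -, -, hc, h⟩ := harc 0 0
    rw [← ker_residue, RingHom.mem_ker, ← hc, ← PowerSeries.coeff_zero_eq_constantCoeff_apply]
    exact PowerSeries.X_pow_dvd_iff.mp h 0 (by norm_num)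
  rw [maximalIdeal_eq] at hrm
  obtain ⟨s, hs, t, ht, rfl⟩ := Submodule.mem_sup.mp hrm
  obtain ⟨c, d, rfl⟩ := Ideal.mem_span_pair.mp hs
  have hcd : ∀ p q, residue k c * p + residue k d * q = 0 := by
    intro p q
    obtain ⟨ρ, hx, hy, hz, hw, hc, h⟩ := harc p q
    have ht0 : ρ t = 0 := by
      obtain ⟨e, f, rfl⟩ := Ideal.mem_span_pair.mp ht
      simp [hz, hw]
    have h1 := PowerSeries.X_pow_dvd_iff.mp h (0 + 1) (by norm_num)
    rw [map_add, ht0, add_zero, map_add, map_mul, map_mul, hx, hy, ← mul_assoc, ← mul_assoc,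
      ← add_mul, PowerSeries.coeff_succ_mul_X, PowerSeries.coeff_zero_eq_constantCoeff_apply,
      map_add, map_mul, map_mul] at h1
    simpa [hc] using h1
  have hc : c ∈ IsLocalRing.maximalIdeal (ExRing k) := by
    rw [← ker_residue, RingHom.mem_ker]
    simpa using hcd 1 0
  have hd : d ∈ IsLocalRing.maximalIdeal (ExRing k) := by
    rw [← ker_residue, RingHom.mem_ker]
    simpa using hcd 0 1
  have hx : x k ∈ IsLocalRing.maximalIdeal (ExRing k) := by
    rw [maximalIdeal_eq]; exact Ideal.mem_sup_left (Ideal.subset_span (by simp))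
  have hy : y k ∈ IsLocalRing.maximalIdeal (ExRing k) := by
    rw [maximalIdeal_eq]; exact Ideal.mem_sup_left (Ideal.subset_span (by simp))
  refine Ideal.add_mem _ (Ideal.mem_sup_left ?_) (Ideal.mem_sup_right ht)
  rw [pow_two]
  exact Ideal.add_mem _ (Ideal.mul_mem_mul hc hx) (Ideal.mul_mem_mul hd hy)

end SallyExample

/-! ### Powers of I modulo I Qⁿ and I Q'ⁿ -/

section Reductions

variable {A : Type*} [CommRing A]

/-- `P n` is what remains of I^(n+1) modulo I Qⁿ. In the induction I² Qⁿ leaves the term P₁ Qⁿ;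
since Q ⊆ I, it is moved into I Q^(n+1) + P_(n+1) one factor of Q at a time by `hP`. -/
theorem pow_succ_le_mul_pow_sup {I Q : Ideal A} (hQI : Q ≤ I) {P : ℕ → Ideal A}
    (h1 : I * I ≤ I * Q ⊔ P 1) (hP : ∀ n, 1 ≤ n → I * P n ≤ I * Q ^ (n + 1) ⊔ P (n + 1)) {n : ℕ}
    (hn : 1 ≤ n) : I ^ (n + 1) ≤ I * Q ^ n ⊔ P n := by
  have hPQ : ∀ n, 1 ≤ n → P 1 * Q ^ (n - 1) ≤ I * Q ^ n ⊔ P n := by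
    intro n hn
    induction n, hn using Nat.le_induction with
    | base => simp
    | succ n hn ih =>
      have : P 1 * Q ^ (n + 1 - 1) = P 1 * Q ^ (n - 1) * Q := by
        rw [mul_assoc, ← pow_succ, Nat.sub_add_cancel hn, Nat.add_sub_cancel]
      rw [this]
      refine (Ideal.mul_mono_left ih).trans ?_
      rw [Ideal.sup_mul, mul_assoc, ← pow_succ]
      refine sup_le le_sup_left (le_trans ?_ (hP n hn))
      rw [mul_comm]
      exact Ideal.mul_mono_left hQI
  induction n, hn using Nat.le_induction with
  | base => simpa [pow_two] using h1
  | succ n hn ih =>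
    rw [pow_succ']
    refine (Ideal.mul_mono_right ih).trans ?_
    rw [Ideal.mul_sup, ← mul_assoc]
    refine sup_le ((Ideal.mul_mono_left h1).trans ?_) (hP n hn)
    rw [Ideal.sup_mul, mul_assoc, ← pow_succ']
    exact sup_le le_sup_left (hPQ (n + 1) (by omega))

end Reductions

namespace SallyExample

variable (k : Type*) [Field k]

theorem I_mul_le {K J : Ideal (ExRing k)} (hxx : ∀ s ∈ K, x k * x k * s ∈ J)
    (hxy : ∀ s ∈ K, x k * y k * s ∈ J) (hyy : ∀ s ∈ K, y k * y k * s ∈ J)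
    (hz : ∀ s ∈ K, z k * s ∈ J) (hw : ∀ s ∈ K, w k * s ∈ J) : I k * K ≤ J := by
  rw [Ideal.mul_le]
  intro r hr s hs
  have : I k ≤ Submodule.comap (LinearMap.mulRight (ExRing k) s) J :=
    I_le_of_mem k (hxx s hs) (hxy s hs) (hyy s hs) (hz s hs) (hw s hs)
  exact this hr

/-- Of the fifteen products of two generators of I, four vanish (x²z, x²w, y²z, y²w) and x²·y²
coincides with (xy)², which leaves ten. -/
theorem I_mul_I_le {J : Ideal (ExRing k)} (h1 : x k ^ 4 ∈ J) (h2 : x k ^ 3 * y k ∈ J)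
    (h3 : x k ^ 2 * y k ^ 2 ∈ J) (h4 : x k * y k ^ 3 ∈ J) (h5 : y k ^ 4 ∈ J)
    (h6 : x k * y k * z k ∈ J) (h7 : x k * y k * w k ∈ J) (h8 : z k ^ 2 ∈ J)
    (h9 : z k * w k ∈ J) (h10 : w k ^ 2 ∈ J) : I k * I k ≤ J := by
  have aux : ∀ r, x k * x k * r ∈ J → x k * y k * r ∈ J → y k * y k * r ∈ J → z k * r ∈ J →
      w k * r ∈ J → ∀ s ∈ I k, r * s ∈ J := by
    intro r h1 h2 h3 h4 h5 s hs
    have : I k ≤ Submodule.comap (LinearMap.mulRight (ExRing k) r) J :=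
      I_le_of_mem k h1 h2 h3 h4 h5
    rw [mul_comm]
    exact this hs
  have e1 : x k * x k * z k = 0 := by rw [← pow_two]; exact xxz k
  have e2 : x k * x k * w k = 0 := by rw [← pow_two]; exact xxw k
  have e3 : y k * y k * z k = 0 := by rw [← pow_two]; exact yyz k
  have e4 : y k * y k * w k = 0 := by rw [← pow_two]; exact yyw k
  have h0 := J.zero_mem
  apply I_mul_le <;> apply aux
  · convert h1 using 1; ring
  · convert h2 using 1; ring
  · convert h3 using 1; ring
  · convert h0 using 1; rw [mul_comm, e1]
  · convert h0 using 1; rw [mul_comm, e2]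
  · convert h2 using 1; ring
  · convert h3 using 1; ring
  · convert h4 using 1; ring
  · rwa [mul_comm]
  · rwa [mul_comm]
  · convert h3 using 1; ring
  · convert h4 using 1; ring
  · convert h5 using 1; ring
  · convert h0 using 1; rw [mul_comm, e3]
  · convert h0 using 1; rw [mul_comm, e4]
  · rwa [e1]
  · exact h6
  · rwa [e3]
  · rwa [← pow_two]
  · rwa [mul_comm]
  · rwa [e2]
  · exact h7
  · rwa [e4]
  · exact h9
  · rwa [← pow_two]

/-- With these signs z - x² and w - y² act as z and w on elements killed by x² and y². -/
theorem Q_eq : Q k = Ideal.span {z k - x k ^ 2, w k - y k ^ 2} := by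
  rw [Q, Ideal.span_insert, Ideal.span_insert, ← neg_sub (x k ^ 2), ← neg_sub (y k ^ 2),
    Ideal.span_singleton_neg, Ideal.span_singleton_neg]

theorem Q'_eq : Q' k = Ideal.span {z k - x k * y k, x k ^ 2 + y k ^ 2 - w k} := by
  rw [Q', Ideal.span_insert, Ideal.span_insert, ← neg_sub (x k * y k), Ideal.span_singleton_neg]

theorem a_mem : z k - x k ^ 2 ∈ Q k := by
  rw [Q_eq]; exact Ideal.subset_span (Or.inl rfl)

theorem b_mem : w k - y k ^ 2 ∈ Q k := by
  rw [Q_eq]; exact Ideal.subset_span (Or.inr rfl)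

theorem a'_mem : z k - x k * y k ∈ Q' k := by
  rw [Q'_eq]; exact Ideal.subset_span (Or.inl rfl)

theorem Q_le : Q k ≤ I k := by
  rw [Q_eq, Ideal.span_le]
  rintro _ (rfl | rfl)
  · rw [pow_two]; exact sub_mem (z_mem k) (xx_mem k)
  · rw [pow_two]; exact sub_mem (w_mem k) (yy_mem k)

theorem Q'_le : Q' k ≤ I k := by
  rw [Q'_eq, Ideal.span_le]
  rintro _ (rfl | rfl)
  · exact sub_mem (z_mem k) (xy_mem k)
  · rw [pow_two, pow_two]; exact sub_mem (add_mem (xx_mem k) (yy_mem k)) (w_mem k)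

/-- The ideal `(z, w)`. -/
noncomputable def N : Ideal (ExRing k) := Ideal.span {z k, w k}

theorem N_le : N k ≤ I k := le_sup_right

theorem z_mem_N : z k ∈ N k := Ideal.subset_span (Or.inl rfl)

theorem w_mem_N : w k ∈ N k := Ideal.subset_span (Or.inr rfl)

theorem xx_mul_N {s : ExRing k} (hs : s ∈ N k) : x k ^ 2 * s = 0 := by
  obtain ⟨c, d, rfl⟩ := Ideal.mem_span_pair.mp hs
  linear_combination c * xxz k + d * xxw k

theorem yy_mul_N {s : ExRing k} (hs : s ∈ N k) : y k ^ 2 * s = 0 := by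
  obtain ⟨c, d, rfl⟩ := Ideal.mem_span_pair.mp hs
  linear_combination c * yyz k + d * yyw k

/-- Modulo I Q, a factor x² may be replaced by z and y² by w next to an element of I. As x² and y²
kill z and w, all products then vanish except x³y ≡ xyz and xy³ ≡ xyw. -/
theorem I_mul_I_le_Q : I k * I k ≤ I k * Q k ⊔ Ideal.span {x k * y k} * N k := by
  have hq : ∀ {c d}, c ∈ I k → d ∈ Q k → c * d ∈ I k * Q k ⊔ Ideal.span {x k * y k} * N k :=
    fun h h' => Ideal.mem_sup_left (Ideal.mul_mem_mul h h')
  have hn : ∀ {s}, s ∈ N k → x k * y k * s ∈ I k * Q k ⊔ Ideal.span {x k * y k} * N k :=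
    fun h => Ideal.mem_sup_right (Ideal.mul_mem_mul (Ideal.mem_span_singleton_self _) h)
  have ha := a_mem k
  have hb := b_mem k
  apply I_mul_I_le
  · convert neg_mem (hq (xx_mem k) ha) using 1; linear_combination xxz k
  · convert sub_mem (hn (z_mem_N k)) (hq (xy_mem k) ha) using 1; ring
  · convert neg_mem (hq (xx_mem k) hb) using 1; linear_combination xxw k
  · convert sub_mem (hn (w_mem_N k)) (hq (xy_mem k) hb) using 1; ring
  · convert neg_mem (hq (yy_mem k) hb) using 1; linear_combination yyw k
  · exact hn (z_mem_N k)
  · exact hn (w_mem_N k)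
  · convert hq (z_mem k) ha using 1; linear_combination xxz k
  · convert hq (z_mem k) hb using 1; linear_combination yyz k
  · convert hq (w_mem k) hb using 1; linear_combination yyw k

theorem I_mul_xyN_le {n : ℕ} (hn : 1 ≤ n) :
    I k * (Ideal.span {x k * y k} * N k ^ n) ≤ Ideal.span {x k * y k} * N k ^ (n + 1) := by
  have h1 : I k * (Ideal.span {x k * y k} * N k) ≤ Ideal.span {x k * y k} * (N k * N k) := by
    have hs : ∀ s ∈ Ideal.span {x k * y k} * N k, ∃ t ∈ N k, x k * y k * t = s := fun s hs =>
      Ideal.mem_span_singleton_mul.mp hs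
    have hxy := Ideal.mem_span_singleton_self (x k * y k)
    apply I_mul_le
    · intro s h
      obtain ⟨t, ht, rfl⟩ := hs s h
      convert Ideal.zero_mem _ using 1
      linear_combination x k * y k * xx_mul_N k ht
    · intro s h
      obtain ⟨t, ht, rfl⟩ := hs s h
      convert Ideal.zero_mem _ using 1
      linear_combination y k ^ 2 * xx_mul_N k ht
    · intro s h
      obtain ⟨t, ht, rfl⟩ := hs s h
      convert Ideal.zero_mem _ using 1
      linear_combination x k * y k * yy_mul_N k ht
    · intro s h
      obtain ⟨t, ht, rfl⟩ := hs s h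
      convert Ideal.mul_mem_mul hxy (Ideal.mul_mem_mul (z_mem_N k) ht) using 1
      ring
    · intro s h
      obtain ⟨t, ht, rfl⟩ := hs s h
      convert Ideal.mul_mem_mul hxy (Ideal.mul_mem_mul (w_mem_N k) ht) using 1
      ring
  obtain ⟨m, rfl⟩ := Nat.exists_eq_add_of_le' hn
  calc I k * (Ideal.span {x k * y k} * N k ^ (m + 1))
      = I k * (Ideal.span {x k * y k} * N k) * N k ^ m := by ring
    _ ≤ Ideal.span {x k * y k} * (N k * N k) * N k ^ m := Ideal.mul_mono_left h1
    _ = Ideal.span {x k * y k} * N k ^ (m + 1 + 1) := by ring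

theorem I_pow_le_Q {n : ℕ} (hn : 1 ≤ n) :
    I k ^ (n + 1) ≤ I k * Q k ^ n ⊔ Ideal.span {x k * y k} * N k ^ n := by
  refine pow_succ_le_mul_pow_sup (Q_le k) (P := fun n => Ideal.span {x k * y k} * N k ^ n) ?_ ?_ hn
  · rw [pow_one]
    exact I_mul_I_le_Q k
  · exact fun n hn => (I_mul_xyN_le k hn).trans le_sup_right

/-- Since x² and y² kill (z, w), z² = z(z - x²), zw = z(w - y²) and w² = w(w - y²). -/
theorem N_pow_succ_le (n : ℕ) : N k ^ (n + 1) ≤ N k * Q k ^ n := by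
  induction n with
  | zero => simp
  | succ n ih =>
    have h : N k * N k ≤ N k * Q k := by
      conv_lhs => rw [N, Ideal.span_pair_mul_span_pair]
      rw [Ideal.span_le]
      have ha := Ideal.mul_mem_mul (z_mem_N k) (a_mem k)
      have hb := Ideal.mul_mem_mul (z_mem_N k) (b_mem k)
      have hc := Ideal.mul_mem_mul (w_mem_N k) (b_mem k)
      have h1 : z k * w k ∈ N k * Q k := by
        convert hb using 1; linear_combination yyz k
      rintro _ (rfl | rfl | rfl | rfl)
      · change z k * z k ∈ N k * Q k
        convert ha using 1; linear_combination xxz k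
      · exact h1
      · exact mul_comm (z k) (w k) ▸ h1
      · change w k * w k ∈ N k * Q k
        convert hc using 1; linear_combination yyw k
    calc N k ^ (n + 1 + 1) = N k ^ (n + 1) * N k := pow_succ _ _
      _ ≤ N k * Q k ^ n * N k := Ideal.mul_mono_left ih
      _ = N k * N k * Q k ^ n := by ring
      _ ≤ N k * Q k * Q k ^ n := Ideal.mul_mono_left h
      _ = N k * Q k ^ (n + 1) := by ring

theorem isIdealReduction_Q : IsIdealReduction (Q k) (I k) := by
  -- The exponent is 2 because the leftover xy(z,w) of I² is absorbed only one step later: xy(z,w)²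
  -- ⊆ xy(z,w)Q.
  refine ⟨Q_le k, 2, le_antisymm ?_ ?_⟩
  · have hxy : Ideal.span {x k * y k} ≤ I k := by
      rw [Ideal.span_singleton_le_iff_mem]; exact xy_mem k
    refine (I_pow_le_Q k (n := 2) (by norm_num)).trans (sup_le ?_ ?_)
    · calc I k * Q k ^ 2 = Q k * (I k * Q k) := by ring
        _ ≤ Q k * (I k * I k) := Ideal.mul_mono_right (Ideal.mul_mono_right (Q_le k))
        _ = Q k * I k ^ 2 := by ring
    · calc Ideal.span {x k * y k} * N k ^ 2 ≤ I k * (N k * Q k ^ 1) :=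
          Ideal.mul_mono hxy (N_pow_succ_le k 1)
        _ ≤ I k * (I k * Q k ^ 1) := Ideal.mul_mono_right (Ideal.mul_mono_left (N_le k))
        _ = Q k * I k ^ 2 := by ring
  · rw [pow_succ' _ 2]
    exact Ideal.mul_mono_left (Q_le k)

/-- x and y kill xy(z,w) because x² and y² kill (z,w); z and w raise the power of (z,w), whose extra
factor is traded for one of Q. Hence the leftover counts only over k. -/
theorem max_mul_xyN_le {n : ℕ} (hn : 1 ≤ n) : IsLocalRing.maximalIdeal (ExRing k) *
    (Ideal.span {x k * y k} * N k ^ n) ≤ I k * Q k ^ n := by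
  rw [maximalIdeal_eq, Ideal.sup_mul]
  refine sup_le ?_ ?_
  · rw [Ideal.mul_le]
    intro r hr s hs
    have hs' : s ∈ Ideal.span {x k * y k} * N k :=
      Ideal.mul_mono_right (Ideal.pow_le_self (by omega)) hs
    obtain ⟨t, ht, rfl⟩ := Ideal.mem_span_singleton_mul.mp hs'
    obtain ⟨c, d, rfl⟩ := Ideal.mem_span_pair.mp hr
    convert Ideal.zero_mem _ using 1
    linear_combination c * y k * xx_mul_N k ht + d * x k * yy_mul_N k ht
  · have hxy : Ideal.span {x k * y k} * N k ≤ I k := Ideal.mul_le_right.trans (N_le k)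
    change N k * _ ≤ _
    calc N k * (Ideal.span {x k * y k} * N k ^ n) = Ideal.span {x k * y k} * N k ^ (n + 1) := by
          ring
      _ ≤ Ideal.span {x k * y k} * (N k * Q k ^ n) := Ideal.mul_mono_right (N_pow_succ_le k n)
      _ = Ideal.span {x k * y k} * N k * Q k ^ n := by ring
      _ ≤ I k * Q k ^ n := Ideal.mul_mono_left hxy

/-- Modulo I Q', xy may be exchanged with z and x² + y² with w. Then x³y ≡ x²z = 0 and xy³ ≡ y²z =
0, hence xyw ≡ 0, while x²y² ≡ z² ≡ xyz and x⁴ ≡ y⁴ ≡ -xyz: one class remains. -/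
theorem I_mul_I_le_Q' : I k * I k ≤ I k * Q' k ⊔ Ideal.span {x k * y k * z k ^ 1} := by
  have hq : ∀ {c d}, c ∈ I k → d ∈ Q' k → c * d ∈ I k * Q' k ⊔ Ideal.span {x k * y k * z k ^ 1} :=
    fun h h' => Ideal.mem_sup_left (Ideal.mul_mem_mul h h')
  have hz : x k * y k * z k ∈ I k * Q' k ⊔ Ideal.span {x k * y k * z k ^ 1} := by
    rw [pow_one]
    exact Ideal.mem_sup_right (Ideal.mem_span_singleton_self _)
  have ha := a'_mem k
  have hb := b'_mem k
  have h3 : x k ^ 3 * y k ∈ I k * Q' k ⊔ Ideal.span {x k * y k * z k ^ 1} := by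
    convert neg_mem (hq (xx_mem k) ha) using 1; linear_combination xxz k
  have h4 : x k * y k ^ 3 ∈ I k * Q' k ⊔ Ideal.span {x k * y k * z k ^ 1} := by
    convert neg_mem (hq (yy_mem k) ha) using 1; linear_combination yyz k
  have h5 : x k ^ 2 * y k ^ 2 ∈ I k * Q' k ⊔ Ideal.span {x k * y k * z k ^ 1} := by
    convert sub_mem hz (hq (xy_mem k) ha) using 1; ring
  apply I_mul_I_le
  · convert sub_mem (hq (xx_mem k) hb) h5 using 1; linear_combination xxw k
  · exact h3
  · exact h5
  · exact h4
  · convert sub_mem (hq (yy_mem k) hb) h5 using 1; linear_combination yyw k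
  · exact hz
  · convert sub_mem (add_mem h3 h4) (hq (xy_mem k) hb) using 1; ring
  · convert add_mem (hq (z_mem k) ha) hz using 1; ring
  · convert neg_mem (hq (z_mem k) hb) using 1; linear_combination xxz k + yyz k
  · convert neg_mem (hq (w_mem k) hb) using 1; linear_combination xxw k + yyw k

theorem xyw_mem : x k * y k * w k ∈ I k * Q' k := by
  have h1 := Ideal.mul_mem_mul (xx_mem k) (a'_mem k)
  have h2 := Ideal.mul_mem_mul (yy_mem k) (a'_mem k)
  have h3 := Ideal.mul_mem_mul (xy_mem k) (b'_mem k)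
  convert neg_mem (add_mem (add_mem h1 h2) h3) using 1
  linear_combination xxz k + yyz k

/-- xy kills xys, since x²s = 0; so z and z - xy act in the same way on xys. -/
theorem xyz_pow_mul_eq (n : ℕ) {s : ExRing k} (hs : s ∈ N k) :
    x k * y k * z k ^ n * s = x k * y k * s * (z k - x k * y k) ^ n := by
  induction n with
  | zero => ring
  | succ n ih =>
    have h := xx_mul_N k hs
    rw [pow_succ (z k - x k * y k), ← mul_assoc, ← ih]
    linear_combination z k ^ n * y k ^ 2 * h

theorem xyzw_mem (n : ℕ) : x k * y k * z k ^ n * w k ∈ I k * Q' k ^ (n + 1) := by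
  rw [xyz_pow_mul_eq k n (w_mem_N k), pow_succ', ← mul_assoc]
  exact Ideal.mul_mem_mul (xyw_mem k) (Ideal.pow_mem_pow (a'_mem k) n)

theorem I_pow_le_Q' {n : ℕ} (hn : 1 ≤ n) :
    I k ^ (n + 1) ≤ I k * Q' k ^ n ⊔ Ideal.span {x k * y k * z k ^ n} := by
  refine pow_succ_le_mul_pow_sup (Q'_le k) (P := fun n => Ideal.span {x k * y k * z k ^ n})
    (I_mul_I_le_Q' k) ?_ hn
  intro n hn
  obtain ⟨m, rfl⟩ := Nat.exists_eq_add_of_le' hn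
  have hs : ∀ s ∈ Ideal.span {x k * y k * z k ^ (m + 1)},
      ∃ c, s = c * (x k * y k * z k ^ (m + 1)) :=
    fun s hs => (Ideal.mem_span_singleton'.mp hs).imp fun _ h => h.symm
  apply I_mul_le
  · intro s h
    obtain ⟨c, rfl⟩ := hs s h
    convert Ideal.zero_mem _ using 1
    linear_combination c * x k * y k * z k ^ m * xxz k
  · intro s h
    obtain ⟨c, rfl⟩ := hs s h
    convert Ideal.zero_mem _ using 1
    linear_combination c * y k ^ 2 * z k ^ m * xxz k
  · intro s h
    obtain ⟨c, rfl⟩ := hs s h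
    convert Ideal.zero_mem _ using 1
    linear_combination c * x k * y k * z k ^ m * yyz k
  · intro s h
    obtain ⟨c, rfl⟩ := hs s h
    refine Ideal.mem_sup_right (Ideal.mem_span_singleton'.mpr ⟨c, ?_⟩)
    ring
  · intro s h
    obtain ⟨c, rfl⟩ := hs s h
    convert Ideal.mem_sup_left (Ideal.mul_mem_left _ c (xyzw_mem k (m + 1))) using 1
    ring

theorem isIdealReduction_Q' : IsIdealReduction (Q' k) (I k) := by
  refine ⟨Q'_le k, 2, le_antisymm ?_ ?_⟩
  · refine (I_pow_le_Q' k (n := 2) (by norm_num)).trans (sup_le ?_ ?_)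
    · calc I k * Q' k ^ 2 = Q' k * (I k * Q' k) := by ring
        _ ≤ Q' k * (I k * I k) := Ideal.mul_mono_right (Ideal.mul_mono_right (Q'_le k))
        _ = Q' k * I k ^ 2 := by ring
    · rw [Ideal.span_singleton_le_iff_mem]
      have h := Ideal.mul_mem_mul (a'_mem k)
        (Ideal.mul_mem_mul (xy_mem k) (z_mem k))
      rw [pow_two (I k)]
      convert h using 1
      linear_combination y k ^ 2 * xxz k
  · rw [pow_succ' _ 2]
    exact Ideal.mul_mono_left (Q'_le k)

theorem max_mul_xyz_le {n : ℕ} (hn : 1 ≤ n) {c : ExRing k}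
    (hc : c ∈ IsLocalRing.maximalIdeal (ExRing k)) :
    c * (x k * y k * z k ^ n) ∈ I k * Q' k ^ n := by
  have h0 : ∀ r ∈ Ideal.span {x k, y k}, r * (x k * y k * z k ^ n) = 0 := by
    intro r hr
    obtain ⟨p, q, rfl⟩ := Ideal.mem_span_pair.mp hr
    obtain ⟨m, rfl⟩ := Nat.exists_eq_add_of_le' hn
    linear_combination p * y k * z k ^ m * xxz k + q * x k * z k ^ m * yyz k
  have h1 : ∀ d ∈ N k, d * (x k * y k * z k ^ n) ∈ I k * Q' k ^ n := by
    intro d hd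
    rw [mul_comm d, xyz_pow_mul_eq k n hd]
    exact Ideal.mul_mem_mul (Ideal.mul_mem_left _ _ (N_le k hd)) (Ideal.pow_mem_pow (a'_mem k) n)
  rw [maximalIdeal_eq] at hc
  obtain ⟨r, hr, d, hd, hrd⟩ := Submodule.mem_sup.mp hc
  rw [← hrd, add_mul, h0 r hr, zero_add]
  exact h1 d hd

end SallyExample

/-! ### Leading forms along arcs -/

section ArcForm

variable {A E K : Type*} [CommRing A] [CommRing E] [CommRing K]

/-- The coefficient of degree `2 (n + 1)` along the arc `ρ`, followed by `Λ`. -/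
noncomputable def arcForm (ρ : A →+* PowerSeries E) (Λ : E →+ K) (n : ℕ) : A →+ K :=
  Λ.comp ((PowerSeries.coeff (2 * (n + 1))).toAddMonoidHom.comp ρ.toAddMonoidHom)

theorem arcForm_apply (ρ : A →+* PowerSeries E) (Λ : E →+ K) (n : ℕ) (g : A) :
    arcForm ρ Λ n g = Λ (PowerSeries.coeff (2 * (n + 1)) (ρ g)) := rfl

/-- An element of I^(n+1) has order at least 2(n + 1) along the arc, so in the coefficient of
exactly that degree only the constant term of ρ c matters. -/
theorem arcForm_mul {ρ : A →+* PowerSeries E} (Λ : E →+ K) {I : Ideal A}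
    (hI : I ≤ (Ideal.span {PowerSeries.X ^ 2}).comap ρ) {n : ℕ} {g : A} (hg : g ∈ I ^ (n + 1))
    {c : A} {s : K} (hs : ∀ e, Λ (PowerSeries.constantCoeff (ρ c) * e) = s * Λ e) :
    arcForm ρ Λ n (c * g) = s * arcForm ρ Λ n g := by
  have h1 : (I ^ (n + 1)).map ρ ≤ Ideal.span {(PowerSeries.X ^ 2 : PowerSeries E)} ^ (n + 1) := by
    rw [Ideal.map_pow]
    exact Ideal.pow_right_mono (Ideal.map_le_iff_le_comap.mpr hI) (n + 1)
  have h2 := h1 (Ideal.mem_map_of_mem ρ hg)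
  rw [Ideal.span_singleton_pow, Ideal.mem_span_singleton', ← pow_mul] at h2
  obtain ⟨h, hh⟩ := h2
  rw [arcForm_apply, arcForm_apply, map_mul, ← hh, ← mul_assoc, PowerSeries.coeff_mul_X_pow',
    PowerSeries.coeff_mul_X_pow', if_pos le_rfl, if_pos le_rfl, Nat.sub_self,
    PowerSeries.coeff_zero_eq_constantCoeff_apply, PowerSeries.coeff_zero_eq_constantCoeff_apply,
    map_mul, hs]

theorem arcForm_succ_mul {ρ : A →+* PowerSeries E} (Λ : E →+ K) {a : A} {u : E}
    (ha : ρ a = PowerSeries.C u * PowerSeries.X ^ 2) {s : K} (hs : ∀ e, Λ (u * e) = s * Λ e)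
    (n : ℕ) (g : A) : arcForm ρ Λ (n + 1) (a * g) = s * arcForm ρ Λ n g := by
  rw [arcForm_apply, arcForm_apply, map_mul, ha, mul_assoc, PowerSeries.coeff_C_mul,
    mul_comm _ (ρ g), PowerSeries.coeff_mul_X_pow', if_pos (by omega), hs]
  congr 2

/-- Forms that are compatible with the multiplication by the generators of `Q` and vanish on `I`
vanish on `I Qⁿ`. -/
theorem form_eq_zero_of_mem {Q I : Ideal A} {a b : A} (hQ : Q = Ideal.span {a, b}) (hQI : Q ≤ I)
    {l : ℕ → A →+ K} {χ : A → K} {s t : K}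
    (hC : ∀ c n, ∀ g ∈ I ^ (n + 1), l n (c * g) = χ c * l n g)
    (hla : ∀ n, ∀ g ∈ I ^ (n + 1), l (n + 1) (a * g) = s * l n g)
    (hlb : ∀ n, ∀ g ∈ I ^ (n + 1), l (n + 1) (b * g) = t * l n g)
    (h0 : ∀ g ∈ I, l 0 g = 0) (n : ℕ) {g : A} (hg : g ∈ I * Q ^ n) : l n g = 0 := by
  induction n generalizing g with
  | zero => exact h0 g (by simpa using hg)
  | succ n ih =>
    rw [pow_succ, ← mul_assoc] at hg
    refine Submodule.mul_induction_on hg ?_ ?_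
    · intro h hh q hq
      obtain ⟨c, d, rfl⟩ := Ideal.mem_span_pair.mp (hQ ▸ hq)
      have hI : h ∈ I ^ (n + 1) := by
        rw [pow_succ']
        exact Ideal.mul_mono_right (Ideal.pow_right_mono hQI n) hh
      have ha : a ∈ I := hQI (hQ ▸ Ideal.subset_span (Or.inl rfl))
      have hb : b ∈ I := hQI (hQ ▸ Ideal.subset_span (Or.inr rfl))
      rw [show h * (c * a + d * b) = c * (a * h) + d * (b * h) by ring, map_add,
        hC c (n + 1) _ (by rw [pow_succ']; exact Ideal.mul_mem_mul ha hI),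
        hC d (n + 1) _ (by rw [pow_succ']; exact Ideal.mul_mem_mul hb hI),
        hla n h hI, hlb n h hI, ih hh]
      simp
    · intro u v hu hv
      rw [map_add, hu, hv, add_zero]

end ArcForm

open scoped QuadraticAlgebra in
/-- The algebra `K[x, y] / (x² - α, y² - β - γ x)`, with the coefficients of `1` and of `xy`. -/
theorem exists_biquadratic.{u} {K : Type u} [CommRing K] (α β γ : K) :
    ∃ (E : Type u) (_ : CommRing E) (_ : Algebra K E) (x y : E) (Λ₁ Λ₂ : E →ₗ[K] K),
      x ^ 2 = algebraMap K E α ∧ y ^ 2 = algebraMap K E β + algebraMap K E γ * x ∧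
      Λ₁ 1 = 1 ∧ Λ₁ x = 0 ∧ Λ₁ (x * y) = 0 ∧ Λ₂ 1 = 0 ∧ Λ₂ (x * y) = 1 := by
  -- A tower of two quadratic extensions, first x² = α, then y² = β + γx; it is free with basis 1,
  -- x, y, xy.
  refine ⟨QuadraticAlgebra (QuadraticAlgebra K α 0) ⟨β, γ⟩ 0, inferInstance, inferInstance,
    ⟨⟨0, 1⟩, 0⟩, ⟨0, 1⟩, ⟨⟨fun e => e.re.re, fun _ _ => rfl⟩, fun _ _ => rfl⟩,
    ⟨⟨fun e => e.im.im, fun _ _ => rfl⟩, fun _ _ => rfl⟩, ?_, ?_, ?_, ?_, ?_, ?_, ?_⟩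
  · rw [Algebra.algebraMap_eq_smul_one]
    ext <;> simp [pow_two]
  · rw [Algebra.algebraMap_eq_smul_one, Algebra.algebraMap_eq_smul_one]
    ext <;> simp [pow_two]
  all_goals simp

namespace SallyExample

variable (k : Type*) [Field k]

theorem form_eq_zero_of_mem_I {K : Type*} [CommRing K] {l : ExRing k →+ K} {χ : ExRing k → K}
    (hC : ∀ c, ∀ g ∈ I k, l (c * g) = χ c * l g) (hxx : l (x k * x k) = 0)
    (hxy : l (x k * y k) = 0) (hyy : l (y k * y k) = 0) (hz : l (z k) = 0) (hw : l (w k) = 0) :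
    ∀ g ∈ I k, l g = 0 := by
  let J : Ideal (ExRing k) :=
    { carrier := {g | g ∈ I k ∧ l g = 0}
      zero_mem' := ⟨zero_mem _, map_zero l⟩
      add_mem' := fun h h' => ⟨add_mem h.1 h'.1, by rw [map_add, h.2, h'.2, add_zero]⟩
      smul_mem' := fun c g h => ⟨Ideal.mul_mem_left _ c h.1, by
        rw [smul_eq_mul, hC c g h.1, h.2, mul_zero]⟩ }
  intro g hg
  exact (I_le_of_mem k (J := J) ⟨xx_mem k, hxx⟩ ⟨xy_mem k, hxy⟩ ⟨yy_mem k, hyy⟩ ⟨z_mem k, hz⟩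
    ⟨w_mem k, hw⟩ hg).2

/-- The form is a homogeneous component of a preimage of s tⁿ in the presentation of the Rees
algebra of (z, w). -/
theorem exists_isHomogeneous_of_mem_N_pow {n : ℕ} {s : ExRing k} (hs : s ∈ N k ^ n) :
    ∃ F : MvPolynomial (Fin 2) (ExRing k), F.IsHomogeneous n ∧
      MvPolynomial.aeval ![z k, w k] F = s := by
  obtain ⟨F, hF⟩ := reesPresentation_surjective (Q := N k) rfl (z_mem_N k) (w_mem_N k)
    ⟨monomial n s, reesAlgebra.monomial_mem.mpr hs⟩
  refine ⟨_, MvPolynomial.homogeneousComponent_isHomogeneous n F, ?_⟩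
  rw [← coeff_reesPresentation (z_mem_N k) (w_mem_N k), hF]
  exact coeff_monomial_same n s

theorem xy_mul_aeval_mem {n : ℕ} (hn : 1 ≤ n) {F : MvPolynomial (Fin 2) (ExRing k)}
    (hF : F.IsHomogeneous n) (h0 : MvPolynomial.map (residue k) F = 0) :
    x k * y k * MvPolynomial.aeval ![z k, w k] F ∈ I k * Q k ^ n := by
  rw [MvPolynomial.aeval_def, MvPolynomial.eval₂_eq', Finset.mul_sum]
  refine Ideal.sum_mem _ fun d hd => max_mul_xyN_le k hn ?_
  rw [mul_left_comm (x k * y k)]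
  refine Ideal.mul_mem_mul ?_ (Ideal.mul_mem_mul (Ideal.mem_span_singleton_self _) ?_)
  · change F.coeff d ∈ _
    rw [← ker_residue, RingHom.mem_ker, ← MvPolynomial.coeff_map, h0, MvPolynomial.coeff_zero]
  · have hdn : d 0 + d 1 = n := by
      rw [← Fin.sum_univ_two, ← Finsupp.degree_eq_sum, Finsupp.degree_eq_weight_one]
      exact hF (MvPolynomial.mem_support_iff.mp hd)
    rw [Fin.prod_univ_two, ← hdn, pow_add]
    exact Ideal.mul_mem_mul (Ideal.pow_mem_pow (z_mem_N k) _) (Ideal.pow_mem_pow (w_mem_N k) _)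

/-- The arcs of `exists_arc`, in an algebra over a `k`-algebra `K`. -/
theorem exists_arc_of_tower {K E : Type*} [CommRing K] [Algebra k K] [CommRing E] [Algebra K E]
    (p q r t : E) (h : (r = 0 ∧ t = 0) ∨ (p ^ 2 = 0 ∧ q ^ 2 = 0)) :
    ∃ ρ : ExRing k →+* PowerSeries E, ρ (x k) = PowerSeries.C p * PowerSeries.X ∧
      ρ (y k) = PowerSeries.C q * PowerSeries.X ∧ ρ (z k) = PowerSeries.C r * PowerSeries.X ^ 2 ∧
      ρ (w k) = PowerSeries.C t * PowerSeries.X ^ 2 ∧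
      ∀ c, PowerSeries.constantCoeff (ρ c) = algebraMap K E (algebraMap k K (residue k c)) := by
  let _ : Algebra k E := ((algebraMap K E).comp (algebraMap k K)).toAlgebra
  exact exists_arc k p q r t h

theorem coeff_two_C_mul {F : Type*} [CommRing F] (c : F) :
    PowerSeries.coeff (2 * (0 + 1)) (PowerSeries.C c * PowerSeries.X ^ 2) = c := by
  rw [PowerSeries.coeff_C_mul, PowerSeries.coeff_X_pow_self, mul_one]

theorem coeff_two_mul {F : Type*} [CommRing F] (c d : F) : PowerSeries.coeff (2 * (0 + 1))
    (PowerSeries.C c * PowerSeries.X * (PowerSeries.C d * PowerSeries.X)) = c * d := by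
  rw [show PowerSeries.C c * PowerSeries.X * (PowerSeries.C d * PowerSeries.X) =
    PowerSeries.C (c * d) * PowerSeries.X ^ 2 by rw [map_mul]; ring, coeff_two_C_mul]

/-- The forms on `I ^ (n + 1)` that detect the Sally module of `I` with respect to `Q`. -/
theorem exists_forms_Q : ∃ l : ℕ → ExRing k →+ MvPolynomial (Fin 2) k,
    (∀ c n, ∀ g ∈ I k ^ (n + 1), l n (c * g) = MvPolynomial.C (residue k c) * l n g) ∧
    (∀ n, ∀ g ∈ I k ^ (n + 1), l (n + 1) ((z k - x k ^ 2) * g) = MvPolynomial.X 0 * l n g) ∧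
    (∀ n, ∀ g ∈ I k ^ (n + 1), l (n + 1) ((w k - y k ^ 2) * g) = MvPolynomial.X 1 * l n g) ∧
    (∀ g ∈ I k, l 0 g = 0) ∧
    ∀ n, ∀ F : MvPolynomial (Fin 2) (ExRing k), F.IsHomogeneous n → 1 ≤ n →
      l n (x k * y k * MvPolynomial.aeval ![z k, w k] F) = MvPolynomial.map (residue k) F := by
  let U : MvPolynomial (Fin 2) k := MvPolynomial.X 0
  let V : MvPolynomial (Fin 2) k := MvPolynomial.X 1
  -- First arc, with x² = y² = 0 and z, w generic: the generators z - x² and w - y² take the values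
  -- U and V.
  obtain ⟨E₁, _, _, x₁, y₁, -, Λ₁, hx₁, hy₁, -, -, -, h10, h11⟩ :=
    exists_biquadratic (0 : MvPolynomial (Fin 2) k) 0 0
  -- Second arc, with z = w = 0: x² = -U and y² = -V give the generators the same values U and V.
  obtain ⟨E₂, _, _, x₂, y₂, -, Λ₂, hx₂, hy₂, -, -, -, h20, h21⟩ :=
    exists_biquadratic (-U) (-V) 0
  simp only [map_zero, zero_mul, add_zero] at hx₁ hy₁ hx₂ hy₂
  obtain ⟨ρ₁, h1x, h1y, h1z, h1w, h1c⟩ := exists_arc_of_tower (K := MvPolynomial (Fin 2) k) k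
    x₁ y₁ (algebraMap (MvPolynomial (Fin 2) k) E₁ U)
    (algebraMap (MvPolynomial (Fin 2) k) E₁ V) (Or.inr ⟨hx₁, hy₁⟩)
  obtain ⟨ρ₂, h2x, h2y, h2z, h2w, h2c⟩ := exists_arc_of_tower (K := MvPolynomial (Fin 2) k) k
    x₂ y₂ 0 0 (Or.inl ⟨rfl, rfl⟩)
  have hI₁ := I_le_comap k h1x h1y h1z h1w
  have hI₂ := I_le_comap k h2x h2y h2z h2w
  -- Both arcs give xy the coefficient 1 at the basis element xy, and x², y², z, w the coefficient
  -- 0; the difference therefore vanishes on I.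
  let l : ℕ → ExRing k →+ MvPolynomial (Fin 2) k := fun n =>
    arcForm ρ₁ Λ₁.toAddMonoidHom n - arcForm ρ₂ Λ₂.toAddMonoidHom n
  have hl : ∀ n g, l n g = arcForm ρ₁ Λ₁.toAddMonoidHom n g - arcForm ρ₂ Λ₂.toAddMonoidHom n g :=
    fun n g => rfl
  have hs₁ : ∀ c e, Λ₁ (algebraMap (MvPolynomial (Fin 2) k) E₁ c * e) = c * Λ₁ e := fun c e => by
    rw [← Algebra.smul_def, map_smul, smul_eq_mul]
  have hs₂ : ∀ c e, Λ₂ (algebraMap (MvPolynomial (Fin 2) k) E₂ c * e) = c * Λ₂ e := fun c e => by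
    rw [← Algebra.smul_def, map_smul, smul_eq_mul]
  have hs₁' : ∀ c, Λ₁ (algebraMap (MvPolynomial (Fin 2) k) E₁ c) = 0 := fun c => by
    rw [← mul_one (algebraMap (MvPolynomial (Fin 2) k) E₁ c), hs₁, h10, mul_zero]
  have hs₂' : ∀ c, Λ₂ (algebraMap (MvPolynomial (Fin 2) k) E₂ c) = 0 := fun c => by
    rw [← mul_one (algebraMap (MvPolynomial (Fin 2) k) E₂ c), hs₂, h20, mul_zero]
  have hC : ∀ c n, ∀ g ∈ I k ^ (n + 1), l n (c * g) = MvPolynomial.C (residue k c) * l n g := by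
    intro c n g hg
    rw [hl, hl, arcForm_mul _ hI₁ hg (fun e => by rw [h1c]; exact hs₁ _ e),
      arcForm_mul _ hI₂ hg (fun e => by rw [h2c]; exact hs₂ _ e), mul_sub]
    rfl
  refine ⟨l, hC, ?_, ?_, ?_, ?_⟩
  · intro n g _
    rw [hl, hl, arcForm_succ_mul _ ?_ (hs₁ U), arcForm_succ_mul _ ?_ (hs₂ U), mul_sub]
    · rw [map_sub, map_pow, h2z, h2x, mul_pow, ← map_pow, hx₂, map_zero, map_neg, map_neg]; ring
    · rw [map_sub, map_pow, h1z, h1x, mul_pow, ← map_pow, hx₁, map_zero]; ring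
  · intro n g _
    rw [hl, hl, arcForm_succ_mul _ ?_ (hs₁ V), arcForm_succ_mul _ ?_ (hs₂ V), mul_sub]
    · rw [map_sub, map_pow, h2w, h2y, mul_pow, ← map_pow, hy₂, map_zero, map_neg, map_neg]; ring
    · rw [map_sub, map_pow, h1w, h1y, mul_pow, ← map_pow, hy₁, map_zero]; ring
  · apply form_eq_zero_of_mem_I k (χ := fun c => MvPolynomial.C (residue k c))
    · intro c g hg
      exact hC c 0 g (by simpa using hg)
    · rw [hl, arcForm_apply, arcForm_apply, map_mul ρ₁, map_mul ρ₂, h1x, h2x, coeff_two_mul,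
        coeff_two_mul, ← pow_two, ← pow_two, hx₁, hx₂]
      simp [-map_neg, hs₂']
    · rw [hl, arcForm_apply, arcForm_apply, map_mul ρ₁, map_mul ρ₂, h1x, h2x, h1y, h2y,
        coeff_two_mul, coeff_two_mul]
      simp [h11, h21]
    · rw [hl, arcForm_apply, arcForm_apply, map_mul ρ₁, map_mul ρ₂, h1y, h2y, coeff_two_mul,
        coeff_two_mul, ← pow_two, ← pow_two, hy₁, hy₂]
      simp [-map_neg, hs₂']
    · rw [hl, arcForm_apply, arcForm_apply, h1z, h2z, coeff_two_C_mul, coeff_two_C_mul]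
      simp [hs₁']
    · rw [hl, arcForm_apply, arcForm_apply, h1w, h2w, coeff_two_C_mul, coeff_two_C_mul]
      simp [hs₁']
  · intro n F hF hn
    -- Here n ≥ 1 is needed: a form of positive degree in z and w dies on the second arc, so the
    -- first one is no longer cancelled.
    have h2 : ρ₂ (MvPolynomial.aeval ![z k, w k] F) = 0 := by
      rw [MvPolynomial.aeval_def, MvPolynomial.hom_eval₂,
        show (fun i => ρ₂ (![z k, w k] i)) = fun _ => 0 by
          funext i; fin_cases i <;> simp [h2z, h2w],
        MvPolynomial.eval₂_eq']
      refine Finset.sum_eq_zero fun d hd => ?_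
      have hdn : ∑ i, d i = n := by
        rw [← Finsupp.degree_eq_sum, Finsupp.degree_eq_weight_one]
        exact hF (MvPolynomial.mem_support_iff.mp hd)
      rw [Finset.prod_pow_eq_pow_sum, hdn, zero_pow (by omega), mul_zero]
    let uv : Fin 2 → E₁ :=
      ![algebraMap (MvPolynomial (Fin 2) k) E₁ U, algebraMap (MvPolynomial (Fin 2) k) E₁ V]
    have h1 : ρ₁ (MvPolynomial.aeval ![z k, w k] F) =
        MvPolynomial.eval₂ ρ₁ (fun i => PowerSeries.C (uv i)) F *
          PowerSeries.X ^ (2 * n) := by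
      rw [← eval₂_C_mul_X_sq ρ₁ _ hF, MvPolynomial.aeval_def, MvPolynomial.hom_eval₂]
      congr 1
      funext i
      fin_cases i
      · exact h1z
      · exact h1w
    have h3 : PowerSeries.constantCoeff (MvPolynomial.eval₂ ρ₁ (fun i => PowerSeries.C
        (uv i)) F) =
        algebraMap (MvPolynomial (Fin 2) k) E₁ (MvPolynomial.map (residue k) F) := by
      rw [← MvPolynomial.eval₂_eta (MvPolynomial.map (residue k) F), MvPolynomial.eval₂_map,
        MvPolynomial.hom_eval₂, MvPolynomial.hom_eval₂]
      congr 1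
      · ext c
        exact h1c c
      · funext i
        fin_cases i <;> simp [uv, U, V]
    rw [hl, arcForm_apply, arcForm_apply, map_mul ρ₁, map_mul ρ₁, map_mul ρ₂, h1, h2, h1x, h1y,
      show PowerSeries.C x₁ * PowerSeries.X * (PowerSeries.C y₁ * PowerSeries.X) *
        (MvPolynomial.eval₂ ρ₁ (fun i => PowerSeries.C (uv i)) F * PowerSeries.X ^ (2 * n)) =
        (MvPolynomial.eval₂ ρ₁ (fun i => PowerSeries.C (uv i)) F * PowerSeries.C (x₁ * y₁)) *
          PowerSeries.X ^ (2 * (n + 1)) by rw [map_mul]; ring,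
      PowerSeries.coeff_mul_X_pow', if_pos le_rfl, Nat.sub_self,
      PowerSeries.coeff_zero_eq_constantCoeff_apply, map_mul, h3, PowerSeries.constantCoeff_C]
    change Λ₁ _ - Λ₂ _ = _
    rw [hs₁, h11]
    simp

end SallyExample

/-! ### The Sally module with respect to Q -/

section FiberConeMaps

theorem exists_injective_lift {T N K : Type*} [CommRing T] [CommRing N] [CommRing K]
    {π : T →+* N} (hπ : Function.Surjective π) {φ : T →+* K} (h : RingHom.ker π = RingHom.ker φ) :
    ∃ g : N →+* K, Function.Injective g ∧ ∀ t, g (π t) = φ t := by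
  have hg : ∀ t, RingHom.liftOfSurjective π hπ ⟨φ, h.le⟩ (π t) = φ t := fun t =>
    RingHom.liftOfRightInverse_comp_apply π _ (Function.rightInverse_surjInv hπ) ⟨φ, h.le⟩ t
  refine ⟨_, ?_, hg⟩
  rw [injective_iff_map_eq_zero]
  intro m hm
  obtain ⟨t, rfl⟩ := hπ m
  rw [hg] at hm
  have : t ∈ RingHom.ker π := h ▸ hm
  exact this

/-- A polynomial differs from its value at V = 0 by a multiple of V. -/
theorem mem_span_X_one_of_aeval_eq_zero {k : Type*} [CommRing k] {p : MvPolynomial (Fin 2) k}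
    (hp : MvPolynomial.aeval ![X, (0 : k[X])] p = 0) :
    p ∈ Ideal.span {(MvPolynomial.X 1 : MvPolynomial (Fin 2) k)} := by
  have h : ∀ p : MvPolynomial (Fin 2) k, p - aeval (MvPolynomial.X 0 : MvPolynomial (Fin 2) k)
      (MvPolynomial.aeval ![X, (0 : k[X])] p) ∈ Ideal.span {MvPolynomial.X 1} := by
    intro p
    induction p using MvPolynomial.induction_on with
    | C c => simp [MvPolynomial.algebraMap_eq]
    | add p q hp hq =>
      convert add_mem hp hq using 1
      simp only [map_add]
      ring
    | mul_X p i hp =>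
      fin_cases i
      · convert Ideal.mul_mem_right (MvPolynomial.X 0) _ hp using 1
        simp
        ring
      · convert Ideal.mul_mem_left _ p (Ideal.mem_span_singleton_self _) using 1
        simp
  have := h p
  rwa [hp, map_zero, sub_zero] at this

variable {A : Type*} [CommRing A] [IsLocalRing A]

theorem algebraMap_fiberConeMod_surjective (Q : Ideal A) (b : A) (hb : b ∈ Q) :
    Function.Surjective (algebraMap (Rees Q) (FiberConeMod Q b hb)) := by
  intro m
  obtain ⟨m, rfl⟩ := Ideal.Quotient.mk_surjective m
  obtain ⟨t, rfl⟩ := Ideal.Quotient.mk_surjective m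
  exact ⟨t, rfl⟩

theorem ker_algebraMap_fiberConeMod (Q : Ideal A) (b : A) (hb : b ∈ Q) :
    RingHom.ker (algebraMap (Rees Q) (FiberConeMod Q b hb)) =
      Ideal.span {reesT Q b hb} ⊔ fiberIdeal Q := by
  have h : RingHom.ker (algebraMap (Rees Q) (FiberConeMod Q b hb)) =
      (Ideal.span {Ideal.Quotient.mk (fiberIdeal Q) (reesT Q b hb)}).comap
        (Ideal.Quotient.mk (fiberIdeal Q)) := by
    ext t
    exact Ideal.Quotient.eq_zero_iff_mem
  rw [h, ← Set.image_singleton, ← Ideal.map_span,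
    Ideal.comap_map_of_surjective _ Ideal.Quotient.mk_surjective, ← RingHom.ker_eq_comap_bot,
    Ideal.mk_ker]

/-- The annihilation by 𝔪R(Q) is carried from N to M, and linearity over the fiber cone is automatic
because the Rees algebra surjects onto it. Ranks can then be computed on N. -/
theorem hasFiberConeRank_of_linearEquiv {Q : Ideal A} {M N : Type*} [AddCommGroup M]
    [Module (Rees Q) M] [AddCommGroup N] [Module (Rees Q) N] [Module (FiberCone Q) N]
    [IsScalarTower (Rees Q) (FiberCone Q) N] (e : M ≃ₗ[Rees Q] N) (hd : IsDomain (FiberCone Q)) :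
    IsDomain (FiberCone Q) ∧ ∃ h : Module.IsTorsionBySet (Rees Q) M (fiberIdeal Q : Set (Rees Q)),
      letI : Module (FiberCone Q) M := h.module
      Nonempty (M ≃ₗ[FiberCone Q] N) := by
  have hs : ∀ (t : Rees Q) (n : N), Ideal.Quotient.mk (fiberIdeal Q) t • n = t • n := by
    intro t n
    rw [← algebraMap_smul (FiberCone Q) t n]
    rfl
  have h : Module.IsTorsionBySet (Rees Q) M (fiberIdeal Q : Set (Rees Q)) := by
    rintro m ⟨t, ht⟩
    apply e.injective
    change e (t • m) = e 0
    rw [map_smul, map_zero, ← hs, Ideal.Quotient.eq_zero_iff_mem.mpr ht, zero_smul]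
  refine ⟨hd, h, ?_⟩
  let _ : Module (FiberCone Q) M := h.module
  refine ⟨{ e with map_smul' := ?_ }⟩
  intro b m
  obtain ⟨t, rfl⟩ := Ideal.Quotient.mk_surjective b
  rw [RingHom.id_apply, hs, Module.IsTorsionBySet.mk_smul]
  exact e.map_smul t m

end FiberConeMaps

namespace SallyExample

variable (k : Type*) [Field k]

theorem aeval_mem_N_pow {n : ℕ} {F : MvPolynomial (Fin 2) (ExRing k)} (hF : F.IsHomogeneous n) :
    MvPolynomial.aeval ![z k, w k] F ∈ N k ^ n := by
  rw [MvPolynomial.aeval_def, MvPolynomial.eval₂_eq']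
  refine Ideal.sum_mem _ fun d hd => Ideal.mul_mem_left _ _ ?_
  have hdn : d 0 + d 1 = n := by
    rw [← Fin.sum_univ_two, ← Finsupp.degree_eq_sum, Finsupp.degree_eq_weight_one]
    exact hF (MvPolynomial.mem_support_iff.mp hd)
  rw [Fin.prod_univ_two, ← hdn, pow_add]
  exact Ideal.mul_mem_mul (Ideal.pow_mem_pow (z_mem_N k) _) (Ideal.pow_mem_pow (w_mem_N k) _)

/-- Modulo I Qⁿ, g is xy F(z, w) with F an n-form, and `l n` returns the residue of F. If that is
zero, F has coefficients in the maximal ideal, which moves xy F(z, w) into I Qⁿ. -/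
theorem mem_I_mul_pow_of_isHomogeneous {l : ℕ → ExRing k →+ MvPolynomial (Fin 2) k}
    (h0 : ∀ g ∈ I k, l 0 g = 0) (hQ : ∀ n, ∀ g ∈ I k * Q k ^ n, l n g = 0)
    (hF : ∀ n, ∀ F : MvPolynomial (Fin 2) (ExRing k), F.IsHomogeneous n → 1 ≤ n →
      l n (x k * y k * MvPolynomial.aeval ![z k, w k] F) = MvPolynomial.map (residue k) F)
    (n : ℕ) {g : ExRing k} (hg : g ∈ I k ^ (n + 1)) :
    (l n g).IsHomogeneous n ∧ (l n g = 0 → g ∈ I k * Q k ^ n) := by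
  rcases Nat.eq_zero_or_pos n with rfl | hn
  · have hg' : g ∈ I k := by simpa using hg
    rw [h0 g hg']
    exact ⟨MvPolynomial.isHomogeneous_zero _ _ _, fun _ => by simpa using hg'⟩
  · obtain ⟨q, hq, p, hp, rfl⟩ := Submodule.mem_sup.mp (I_pow_le_Q k hn hg)
    obtain ⟨s, hs, rfl⟩ := Ideal.mem_span_singleton_mul.mp hp
    obtain ⟨F, hF1, rfl⟩ := exists_isHomogeneous_of_mem_N_pow k hs
    rw [map_add, hQ n q hq, zero_add, hF n F hF1 hn]
    exact ⟨hF1.map _, fun h => add_mem hq (xy_mul_aeval_mem k hn hF1 h)⟩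

/-- S_Q(I) (through the forms) and B₊ (through B ≅ k[U,V]) both embed in k[U,V], and both images
consist of the polynomials without constant term. -/
theorem gradedIso_Q_and_isDomain :
    GradedIso (Rees (Q k)) (sallyDegree (Q k) (I k)) (fiberConePlusDegree (Q k)) ∧
      IsDomain (FiberCone (Q k)) ∧ fiberConePlus (Q k) ≠ ⊥ := by
  obtain ⟨φ, hφs, hφk, hφC, hφa, hφb, hφd, hφl⟩ :=
    (hasQuadraticArcs_Q k).exists_fiberConeHom (residue_surjective k) (ker_residue k) (Q_eq k)
      (a_mem k) (b_mem k)
  obtain ⟨l, hC, hla, hlb, h0, hlF⟩ := exists_forms_Q k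
  have hlQ : ∀ n, ∀ g ∈ I k * Q k ^ n, l n g = 0 := fun n g hg =>
    form_eq_zero_of_mem (Q_eq k) (Q_le k) hC hla hlb h0 n hg
  have hlh := fun n g (hg : g ∈ I k ^ (n + 1)) =>
    mem_I_mul_pow_of_isHomogeneous k h0 hlQ hlF n hg
  obtain ⟨f, hfi, hfs, hfd, hf1, hf2⟩ := exists_sallyHom (Q_eq k) (a_mem k) (b_mem k) (Q_le k) φ l
    (fun n => (MvPolynomial.homogeneousComponent n).toAddMonoidHom)
    (by intro c n g hg; rw [hφC, hC c n g hg])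
    (by intro n g hg; rw [hφa, hla n g hg])
    (by intro n g hg; rw [hφb, hlb n g hg])
    (by
      intro n g hg j
      have := MvPolynomial.homogeneousComponent_of_mem (m := j) (hlh n g hg).1
      simpa using this)
    (fun n g hg => ⟨(hlh n g hg).2, hlQ n g⟩)
  obtain ⟨ψ, hψi, hψ⟩ := exists_injective_lift (π := Ideal.Quotient.mk (fiberIdeal (Q k)))
    Ideal.Quotient.mk_surjective (φ := φ) (by rw [Ideal.mk_ker, hφk])
  have hdeg : ∀ n (b : FiberCone (Q k)), b ∈ inducedDegree (Q k) (FiberCone (Q k)) n ↔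
      (ψ b).IsHomogeneous n := by
    intro n b
    constructor
    · rintro ⟨r, hr, rfl⟩
      have := hφd n r hr
      rw [← hψ] at this
      exact this
    · intro h
      obtain ⟨r, hr, hrb⟩ := hφl n _ h
      refine ⟨r, hr, hψi ?_⟩
      rw [← hrb]
      exact hψ r
  have hcomp : ∀ n (v : MvPolynomial (Fin 2) k),
      MvPolynomial.homogeneousComponent n v = v ↔ v.IsHomogeneous n := by
    intro n v
    constructor
    · intro h
      rw [← h]
      exact MvPolynomial.homogeneousComponent_isHomogeneous n v
    · intro h
      rw [MvPolynomial.homogeneousComponent_of_mem h, if_pos rfl]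
  have hplus : ∀ n, 0 < n → ∀ v : MvPolynomial (Fin 2) k, v.IsHomogeneous n →
      ∃ b ∈ fiberConePlus (Q k), ψ b = v := by
    intro n hn v hv
    obtain ⟨r, hr, rfl⟩ := hφl n v hv
    exact ⟨Ideal.Quotient.mk _ r, Ideal.subset_span ⟨n, hn, r, hr, rfl⟩, hψ r⟩
  let g : fiberConePlus (Q k) →+ MvPolynomial (Fin 2) k :=
    ψ.toAddMonoidHom.comp (fiberConePlus (Q k)).subtype.toAddMonoidHom
  have hg : ∀ b, g b = ψ b.1 := fun b => rfl
  have hgr : ∀ b, b ∈ fiberConePlus (Q k) → MvPolynomial.constantCoeff (ψ b) = 0 := by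
    have : fiberConePlus (Q k) ≤ RingHom.ker (MvPolynomial.constantCoeff.comp ψ) := by
      rw [fiberConePlus, Ideal.span_le]
      rintro b ⟨n, hn, hb⟩
      have := (hdeg n b).mp hb
      by_contra h
      have h1 := this (d := 0) h
      simp at h1
      omega
    exact fun b hb => this hb
  refine ⟨?_, hψi.isDomain ψ, ?_⟩
  · refine gradedIso_of_semilinear φ (fun n => {v | v.IsHomogeneous n}) f g hfs ?_ hfi ?_ ?_ ?_ ?_
    · intro r b
      rw [hg, hg, ← hψ, ← map_mul]
      rfl
    · exact fun b c h => Subtype.ext (hψi h)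
    · apply le_antisymm
      · apply hf2
        intro n c hc
        rcases Nat.eq_zero_or_pos n with rfl | hn
        · rw [h0 c (by simpa using hc)]
          exact zero_mem _
        · obtain ⟨b, hb, hbv⟩ := hplus n hn _ (hlh n c hc).1
          exact ⟨⟨b, hb⟩, hbv⟩
      · rintro _ ⟨⟨b, hb⟩, rfl⟩
        rw [hg, ← MvPolynomial.sum_homogeneousComponent (ψ b)]
        refine AddSubgroup.sum_mem _ fun n _ => ?_
        rcases Nat.eq_zero_or_pos n with rfl | hn
        · rw [MvPolynomial.homogeneousComponent_zero, ← MvPolynomial.constantCoeff_eq, hgr b hb,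
            MvPolynomial.C_0]
          exact zero_mem _
        -- Lifting the degree n component to a form F over A exhibits it as the value of the form at
        -- xy F(z, w) ∈ I^(n+1).
        · obtain ⟨F, hF⟩ := MvPolynomial.map_surjective (σ := Fin 2) (residue k)
            (residue_surjective k) (ψ b)
          have := hlF n _ (MvPolynomial.homogeneousComponent_isHomogeneous n F) hn
          have hmap : MvPolynomial.map (residue k) (MvPolynomial.homogeneousComponent n F) =
              MvPolynomial.homogeneousComponent n (ψ b) := by
            rw [← hF]
            ext d
            simp only [MvPolynomial.coeff_map, MvPolynomial.coeff_homogeneousComponent]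
            split_ifs <;> simp
          rw [← hmap, ← this]
          apply hf1
          rw [pow_succ']
          exact Ideal.mul_mem_mul (xy_mem k) (Ideal.pow_right_mono (N_le k) n
            (aeval_mem_N_pow k (MvPolynomial.homogeneousComponent_isHomogeneous n F)))
    · intro n s
      rw [hfd]
      exact hcomp n _
    · intro n b
      exact hdeg n b.1
  · intro h
    obtain ⟨b, hb, hbv⟩ := hplus 1 one_pos (MvPolynomial.X 0) (MvPolynomial.isHomogeneous_X _ _)
    rw [h, Submodule.mem_bot] at hb
    rw [hb, map_zero] at hbv
    exact MvPolynomial.X_ne_zero 0 hbv.symm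

theorem hasFiberConeRank_Q : HasFiberConeRank (Q k) (SallyModule (Q k) (I k)) 1 := by
  obtain ⟨⟨e, -⟩, hd, hne⟩ := gradedIso_Q_and_isDomain k
  obtain ⟨-, h, ⟨e'⟩⟩ := hasFiberConeRank_of_linearEquiv e hd
  refine ⟨hd, h, ?_⟩
  let _ : Module (FiberCone (Q k)) (SallyModule (Q k) (I k)) := h.module
  -- A nonzero ideal of a domain has rank one.
  have hr : Module.rank (FiberCone (Q k)) (fiberConePlus (Q k)) = 1 := by
    apply le_antisymm
    · exact (Submodule.rank_le _).trans (Module.rank_self _).le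
    · rw [Cardinal.one_le_iff_ne_zero, Ne, rank_zero_iff]
      intro h0
      exact hne (Submodule.subsingleton_iff_eq_bot.mp h0)
  exact e'.rank_eq.trans hr

end SallyExample

/-! ### The Sally module with respect to Q' -/

theorem exists_aeval_X_zero_eq_monomial {k : Type*} [CommRing k] {n : ℕ}
    {F : MvPolynomial (Fin 2) k} (hF : F.IsHomogeneous n) :
    ∃ c, MvPolynomial.aeval ![X, (0 : k[X])] F = monomial n c := by
  have h : MvPolynomial.aeval ![X, (0 : k[X])] F ∈ LinearMap.range (monomial (R := k) n) := by
    rw [MvPolynomial.aeval_def, MvPolynomial.eval₂_eq']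
    refine Submodule.sum_mem _ fun d hd => ?_
    have hdn : d 0 + d 1 = n := by
      rw [← Fin.sum_univ_two, ← Finsupp.degree_eq_sum, Finsupp.degree_eq_weight_one]
      exact hF (MvPolynomial.mem_support_iff.mp hd)
    rw [Fin.prod_univ_two]
    rcases Nat.eq_zero_or_pos (d 1) with h1 | h1
    · refine ⟨F.coeff d, ?_⟩
      rw [← C_mul_X_pow_eq_monomial, ← hdn, h1]
      simp
    · convert Submodule.zero_mem _ using 1
      simp [h1.ne']
  exact h.imp fun _ h => h.symm

namespace SallyExample

variable (k : Type*) [Field k]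

/-- The forms on `I ^ (n + 1)` that detect the Sally module of `I` with respect to `Q'`. -/
theorem exists_forms_Q' : ∃ l : ℕ → ExRing k →+ k[X],
    (∀ c n, ∀ g ∈ I k ^ (n + 1), l n (c * g) = C (residue k c) * l n g) ∧
    (∀ n, ∀ g ∈ I k ^ (n + 1), l (n + 1) ((z k - x k * y k) * g) = X * l n g) ∧
    (∀ n, ∀ g ∈ I k ^ (n + 1), l (n + 1) ((x k ^ 2 + y k ^ 2 - w k) * g) = 0 * l n g) ∧
    (∀ g ∈ I k, l 0 g = 0) ∧ ∀ n, 1 ≤ n → l n (x k * y k * z k ^ n) = X ^ (n + 1) := by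
  let U : k[X] := X
  -- First arc: x² = y² = 0, z = xy + U, w = 0, so that z - xy takes the value U and x² + y² - w the
  -- value 0.
  obtain ⟨E₁, _, _, x₁, y₁, Λ₁, Λ₂, hx₁, hy₁, h10, -, h12, h13, h14⟩ :=
    exists_biquadratic (0 : k[X]) 0 0
  -- Second arc: z = w = 0 requires xy = -U and x² + y² = 0. With e² = -1 and f² = Ue, the choice x
  -- = ef, y = f gives xy = Ue² = -U and x² = -y².
  obtain ⟨E₂, _, _, e, f, M, -, he, hf, h20, h21, -, -, -⟩ :=
    exists_biquadratic (-1 : k[X]) 0 U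
  simp only [map_zero, zero_mul, zero_add, add_zero, map_neg, map_one] at hx₁ hy₁ he hf
  set u₁ := algebraMap k[X] E₁ U with hu₁
  set u₂ := algebraMap k[X] E₂ U with hu₂
  obtain ⟨ρ₁, h1x, h1y, h1z, h1w, h1c⟩ := exists_arc_of_tower (K := k[X]) k
    x₁ y₁ (x₁ * y₁ + u₁) 0 (Or.inr ⟨hx₁, hy₁⟩)
  obtain ⟨ρ₂, h2x, h2y, h2z, h2w, h2c⟩ := exists_arc_of_tower (K := k[X]) k
    (e * f) f 0 0 (Or.inl ⟨rfl, rfl⟩)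
  have hI₁ := I_le_comap k h1x h1y h1z h1w
  have hI₂ := I_le_comap k h2x h2y h2z h2w
  -- L takes xy to U and 1 to -1. So it kills z = xy + U, and its value U at xy cancels the value -U
  -- of the second arc; thus the sum of the two vanishes on I.
  let L : E₁ →ₗ[k[X]] k[X] := U • Λ₂ - Λ₁
  have hL : ∀ v, L v = U * Λ₂ v - Λ₁ v := fun v => rfl
  let l : ℕ → ExRing k →+ k[X] := fun n =>
    arcForm ρ₁ L.toAddMonoidHom n + arcForm ρ₂ M.toAddMonoidHom n
  have hl : ∀ n g, l n g = L (PowerSeries.coeff (2 * (n + 1)) (ρ₁ g)) +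
      M (PowerSeries.coeff (2 * (n + 1)) (ρ₂ g)) := fun n g => rfl
  have hl' : ∀ n g, l n g = arcForm ρ₁ L.toAddMonoidHom n g + arcForm ρ₂ M.toAddMonoidHom n g :=
    fun n g => rfl
  have hs₁ : ∀ c v, L (algebraMap k[X] E₁ c * v) = c * L v := fun c v => by
    rw [← Algebra.smul_def, map_smul, smul_eq_mul]
  have hs₂ : ∀ c v, M (algebraMap k[X] E₂ c * v) = c * M v := fun c v => by
    rw [← Algebra.smul_def, map_smul, smul_eq_mul]
  have hLxy : L (x₁ * y₁) = U := by rw [hL, h12, h14]; ring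
  have hL1 : L 1 = -1 := by rw [hL, h10, h13]; ring
  have hC : ∀ c n, ∀ g ∈ I k ^ (n + 1), l n (c * g) = C (residue k c) * l n g := by
    intro c n g hg
    rw [hl', hl', arcForm_mul _ hI₁ hg (fun v => by rw [h1c]; exact hs₁ _ v),
      arcForm_mul _ hI₂ hg (fun v => by rw [h2c]; exact hs₂ _ v), mul_add]
    rfl
  refine ⟨l, hC, ?_, ?_, ?_, ?_⟩
  · intro n g _
    rw [hl', hl', arcForm_succ_mul _ ?_ (hs₁ U), arcForm_succ_mul _ ?_ (hs₂ U), mul_add]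
    · rw [map_sub, map_mul ρ₂, h2z, h2x, h2y, ← hu₂, show PowerSeries.C (e * f) * PowerSeries.X *
        (PowerSeries.C f * PowerSeries.X) = PowerSeries.C (e * f ^ 2) * PowerSeries.X ^ 2 by
          simp only [map_mul, map_pow]; ring, hf,
        show e * (u₂ * e) = -u₂ by linear_combination u₂ * he, map_zero, map_neg]
      ring
    · rw [map_sub, map_mul ρ₁, h1z, h1x, h1y, ← hu₁, map_add, map_mul]
      ring
  · intro n g _
    rw [hl', hl', arcForm_succ_mul (u := 0) (s := 0) _ ?_ ?_,
      arcForm_succ_mul (u := 0) (s := 0) _ ?_ ?_, mul_add]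
    · rw [map_sub, map_add, map_pow, map_pow, h2w, h2x, h2y, mul_pow, mul_pow, ← map_pow, ← map_pow,
        mul_pow, he, hf, map_zero, ← add_mul, ← map_add, show -1 * (u₂ * e) + u₂ * e = 0 by ring,
        map_zero]
      ring
    · intro v; simp
    · rw [map_sub, map_add, map_pow, map_pow, h1w, h1x, h1y, mul_pow, mul_pow, ← map_pow, ← map_pow,
        hx₁, hy₁, map_zero]
      ring
    · intro v; simp
  · apply form_eq_zero_of_mem_I k (χ := fun c => C (residue k c))
    · intro c g hg
      exact hC c 0 g (by simpa using hg)
    · rw [hl, map_mul ρ₁, map_mul ρ₂, h1x, h2x, coeff_two_mul,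
        coeff_two_mul, ← pow_two, ← pow_two, hx₁, mul_pow, he, hf,
        show -1 * (u₂ * e) = -(u₂ * e) by ring, map_zero, map_neg, hs₂, h21]
      simp
    · rw [hl, map_mul ρ₁, map_mul ρ₂, h1x, h2x, h1y, h2y, coeff_two_mul, coeff_two_mul, hLxy,
        mul_assoc, ← pow_two, hf, show e * (u₂ * e) = u₂ * -1 by linear_combination u₂ * he, hs₂,
        map_neg, h20]
      ring
    · rw [hl, map_mul ρ₁, map_mul ρ₂, h1y, h2y, coeff_two_mul, coeff_two_mul, ← pow_two, ← pow_two,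
        hy₁, hf, hs₂, h21]
      simp
    · rw [hl, h1z, h2z, coeff_two_C_mul, coeff_two_C_mul, map_add, hLxy, hu₁,
        ← mul_one (algebraMap k[X] E₁ U), hs₁, hL1, map_zero]
      ring
    · rw [hl, h1w, h2w, coeff_two_C_mul, coeff_two_C_mul]
      simp
  · intro n hn
    have h1 : ρ₁ (x k * y k * z k ^ n) =
        PowerSeries.C (algebraMap k[X] E₁ (U ^ n) * (x₁ * y₁)) * PowerSeries.X ^ (2 * (n + 1)) := by
      -- As (xy)² = 0 in E₁, z = xy + U multiplies xy as U does.
      have hpow : ∀ n, x₁ * y₁ * (x₁ * y₁ + u₁) ^ n = u₁ ^ n * (x₁ * y₁) := by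
        intro n
        induction n with
        | zero => ring
        | succ n ih =>
          rw [pow_succ, ← mul_assoc, ih]
          linear_combination u₁ ^ n * y₁ ^ 2 * hx₁
      rw [map_pow, ← hu₁, ← hpow, map_mul ρ₁, map_mul ρ₁, map_pow, h1x, h1y, h1z, mul_pow,
        ← pow_mul, map_mul, map_mul, map_pow]
      ring
    have h2 : ρ₂ (x k * y k * z k ^ n) = 0 := by
      rw [map_mul ρ₂, map_pow, h2z, map_zero, zero_mul, zero_pow (by omega), mul_zero]
    rw [hl, h1, h2, PowerSeries.coeff_C_mul, PowerSeries.coeff_X_pow_self, mul_one, hs₁, hLxy,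
      map_zero, map_zero, add_zero, pow_succ]

theorem xyz_pow_mem (n : ℕ) : x k * y k * z k ^ n ∈ I k ^ (n + 1) := by
  rw [pow_succ']
  exact Ideal.mul_mem_mul (xy_mem k) (Ideal.pow_mem_pow (z_mem k) n)

/-- The degree n part of the Sally module is spanned by the class of xyzⁿ, with value X^(n+1). In
degree zero the Sally module vanishes, whence the extra clause for n = 0. -/
theorem exists_form_Q'_eq {l : ℕ → ExRing k →+ k[X]}
    (hC : ∀ c n, ∀ g ∈ I k ^ (n + 1), l n (c * g) = C (residue k c) * l n g)
    (h0 : ∀ g ∈ I k, l 0 g = 0) (hQ : ∀ n, ∀ g ∈ I k * Q' k ^ n, l n g = 0)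
    (hF : ∀ n, 1 ≤ n → l n (x k * y k * z k ^ n) = X ^ (n + 1)) (n : ℕ) {g : ExRing k}
    (hg : g ∈ I k ^ (n + 1)) :
    ∃ c, l n g = monomial (n + 1) c ∧ (n = 0 → c = 0) ∧ (c = 0 → g ∈ I k * Q' k ^ n) := by
  rcases Nat.eq_zero_or_pos n with rfl | hn
  · have hg' : g ∈ I k := by simpa using hg
    exact ⟨0, by rw [h0 g hg', map_zero], fun _ => rfl, fun _ => by simpa using hg'⟩
  · obtain ⟨q, hq, p, hp, rfl⟩ := Submodule.mem_sup.mp (I_pow_le_Q' k hn hg)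
    obtain ⟨c, rfl⟩ := Ideal.mem_span_singleton'.mp hp
    refine ⟨residue k c, ?_, fun h => absurd h hn.ne', fun h => ?_⟩
    · rw [map_add, hQ n q hq, zero_add, hC c n _ (xyz_pow_mem k n), hF n hn,
        C_mul_X_pow_eq_monomial]
    · exact add_mem hq (max_mul_xyz_le k hn (by rwa [← ker_residue, RingHom.mem_ker]))

/-- The quotient of B' by its second variable is k[X]. The Sally module has image X²k[X], its degree
n part lying in degree n + 1, so multiplication by X² on k[X] realises the shift by one. -/
theorem gradedIso_Q'_and_isDomain :
    GradedIso (Rees (Q' k)) (sallyDegree (Q' k) (I k))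
      (shiftDegree (inducedDegree (Q' k) (FiberConeMod (Q' k) _ (b'_mem k)))) ∧
    IsDomain (FiberCone (Q' k)) ∧
      algebraMap (Rees (Q' k)) (FiberCone (Q' k)) (reesT (Q' k) _ (b'_mem k)) ≠ 0 := by
  obtain ⟨φ, hφs, hφk, hφC, hφa, hφb, hφd, hφl⟩ :=
    (hasQuadraticArcs_Q' k).exists_fiberConeHom (residue_surjective k) (ker_residue k) (Q'_eq k)
      (a'_mem k) (b'_mem k)
  obtain ⟨l, hC, hla, hlb, h0, hlF⟩ := exists_forms_Q' k
  have hlQ : ∀ n, ∀ g ∈ I k * Q' k ^ n, l n g = 0 := fun n g hg =>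
    form_eq_zero_of_mem (Q'_eq k) (Q'_le k) hC hla hlb h0 n hg
  have hlh := fun n g (hg : g ∈ I k ^ (n + 1)) => exists_form_Q'_eq k hC h0 hlQ hlF n hg
  let ev : MvPolynomial (Fin 2) k →+* k[X] := (MvPolynomial.aeval ![X, (0 : k[X])]).toRingHom
  have hev : ∀ p, ev p = MvPolynomial.aeval ![X, (0 : k[X])] p := fun p => rfl
  obtain ⟨f, hfi, hfs, hfd, hf1, hf2⟩ := exists_sallyHom (Q'_eq k) (a'_mem k) (b'_mem k) (Q'_le k)
    (ev.comp φ) l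
    (fun n => (monomial (n + 1)).toAddMonoidHom.comp (lcoeff k (n + 1)).toAddMonoidHom)
    (by
      intro c n g hg
      rw [hC c n g hg, RingHom.comp_apply, hφC, hev, MvPolynomial.aeval_C]
      rfl)
    (by intro n g hg; rw [hla n g hg, RingHom.comp_apply, hφa, hev]; simp)
    (by intro n g hg; rw [hlb n g hg, RingHom.comp_apply, hφb, hev]; simp)
    (by
      intro n g hg j
      obtain ⟨c, hc, -⟩ := hlh n g hg
      change monomial (j + 1) ((l n g).coeff (j + 1)) = _
      rw [hc, coeff_monomial]
      split_ifs with h1 h2 h2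
      · rw [h2]
      · omega
      · omega
      · rw [map_zero])
    (by
      intro n g hg
      refine ⟨fun h => ?_, hlQ n g⟩
      obtain ⟨c, hc, -, hc0⟩ := hlh n g hg
      rw [hc, monomial_eq_zero_iff] at h
      exact hc0 h)
  have hπ := algebraMap_fiberConeMod_surjective (Q' k) _ (b'_mem k)
  obtain ⟨ψ, hψi, hψ⟩ := exists_injective_lift hπ (φ := ev.comp φ) (by
    rw [ker_algebraMap_fiberConeMod]
    apply le_antisymm
    · rw [sup_le_iff, Ideal.span_singleton_le_iff_mem, ← hφk]
      constructor
      · rw [RingHom.mem_ker, RingHom.comp_apply, hφb, hev]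
        simp
      · intro t ht
        rw [RingHom.mem_ker] at ht ⊢
        rw [RingHom.comp_apply, ht, map_zero]
    · intro t ht
      obtain ⟨p, hp⟩ := Ideal.mem_span_singleton'.mp (mem_span_X_one_of_aeval_eq_zero ht)
      obtain ⟨s, rfl⟩ := hφs p
      rw [show t = s * reesT (Q' k) _ (b'_mem k) + (t - s * reesT (Q' k) _ (b'_mem k)) by ring]
      refine Submodule.add_mem_sup (Ideal.mul_mem_left _ _ (Ideal.mem_span_singleton_self _)) ?_
      rw [← hφk, RingHom.mem_ker, map_sub, map_mul, hφb, hp, sub_self])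
  have hdeg : ∀ n b, b ∈ inducedDegree (Q' k) (FiberConeMod (Q' k) _ (b'_mem k)) n ↔
      ∃ c, ψ b = monomial n c := by
    intro n b
    constructor
    · rintro ⟨r, hr, rfl⟩
      obtain ⟨c, hc⟩ := exists_aeval_X_zero_eq_monomial (hφd n r hr)
      exact ⟨c, (hψ r).trans hc⟩
    · rintro ⟨c, hc⟩
      obtain ⟨r, hr, hrb⟩ := hφl n (MvPolynomial.C c * MvPolynomial.X 0 ^ n)
        ((MvPolynomial.isHomogeneous_C_mul_X_pow c 0 n))
      refine ⟨r, hr, hψi ?_⟩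
      change ψ (algebraMap _ _ r) = _
      rw [hψ, hc, RingHom.comp_apply, hrb, hev, ← C_mul_X_pow_eq_monomial]
      simp
  have hψs : Function.Surjective ψ := by
    intro p
    obtain ⟨t, ht⟩ := hφs (aeval (MvPolynomial.X 0) p)
    refine ⟨algebraMap _ _ t, ?_⟩
    rw [hψ, RingHom.comp_apply, ht, hev]
    exact (aeval_algHom_apply _ _ _).symm.trans (by simp)
  -- Degree n - 1 of the quotient ring must meet degree n of the Sally module, which sits in degree
  -- n + 1 of k[X]; hence the factor X².
  let g : FiberConeMod (Q' k) _ (b'_mem k) →+ k[X] :=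
    (AddMonoidHom.mulLeft (X ^ 2)).comp ψ.toAddMonoidHom
  have hg : ∀ b, g b = X ^ 2 * ψ b := fun b => rfl
  refine ⟨?_, ?_, ?_⟩
  · refine gradedIso_of_semilinear (ev.comp φ)
      (fun n => {v | monomial (n + 1) (v.coeff (n + 1)) = v}) f g hfs ?_ hfi ?_ ?_ hfd ?_
    · intro r b
      obtain ⟨t, rfl⟩ := hπ b
      have h : r • algebraMap (Rees (Q' k)) (FiberConeMod (Q' k) _ (b'_mem k)) t =
        algebraMap (Rees (Q' k)) (FiberConeMod (Q' k) _ (b'_mem k)) (r * t) := rfl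
      rw [hg, hg, h, hψ, hψ, map_mul]
      ring
    · intro b c h
      exact hψi (mul_left_cancel₀ (pow_ne_zero 2 X_ne_zero) h)
    · apply le_antisymm
      · apply hf2
        intro n c hc
        obtain ⟨d, hd, hd0, -⟩ := hlh n c hc
        rw [hd]
        rcases Nat.eq_zero_or_pos n with rfl | hn
        · rw [hd0 rfl, map_zero]
          exact zero_mem _
        · obtain ⟨b, hb⟩ := hψs (monomial (n - 1) d)
          refine ⟨b, ?_⟩
          rw [hg, hb, X_pow_mul_monomial]
          congr 2
          omega
      · rintro _ ⟨b, rfl⟩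
        rw [hg]
        induction ψ b using Polynomial.induction_on' with
        | add p q hp hq =>
          rw [mul_add]
          exact add_mem hp hq
        | monomial n c =>
          obtain ⟨d, rfl⟩ := residue_surjective k c
          have := hf1 (n + 1) (d * (x k * y k * z k ^ (n + 1)))
            (Ideal.mul_mem_left _ _ (xyz_pow_mem k (n + 1)))
          rw [hC d (n + 1) _ (xyz_pow_mem k (n + 1)), hlF (n + 1) (by omega),
            C_mul_X_pow_eq_monomial] at this
          rwa [X_pow_mul_monomial]
    · intro n b
      rw [Set.mem_ofPred_eq, hg]
      cases n with
      | zero =>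
        have h1 : (X ^ 2 * ψ b).coeff (0 + 1) = 0 := by
          rw [coeff_X_pow_mul', if_neg (by norm_num)]
        rw [h1, map_zero]
        constructor
        · intro hb
          rw [show b = 0 from hb, map_zero, mul_zero]
        · intro hb
          have h2 := (mul_eq_zero.mp hb.symm).resolve_left (pow_ne_zero 2 X_ne_zero)
          exact hψi (h2.trans (map_zero ψ).symm)
      | succ n =>
        refine (hdeg n b).trans ?_
        have h1 : (X ^ 2 * ψ b).coeff (n + 1 + 1) = (ψ b).coeff n := coeff_X_pow_mul _ 2 n
        rw [h1, show monomial (n + 1 + 1) ((ψ b).coeff n) = X ^ 2 * monomial n ((ψ b).coeff n) by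
          rw [X_pow_mul_monomial]]
        constructor
        · rintro ⟨c, hc⟩
          rw [hc, coeff_monomial_same]
        · intro h
          exact ⟨_, (mul_left_cancel₀ (pow_ne_zero 2 X_ne_zero) h).symm⟩
  · obtain ⟨χ, hχ, -⟩ := exists_injective_lift (π := Ideal.Quotient.mk (fiberIdeal (Q' k)))
      Ideal.Quotient.mk_surjective (φ := φ) (by rw [Ideal.mk_ker, hφk])
    exact hχ.isDomain χ
  · intro h
    have h1 : reesT (Q' k) _ (b'_mem k) ∈ RingHom.ker φ := by
      rw [hφk]
      exact Ideal.Quotient.eq_zero_iff_mem.mp h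
    rw [RingHom.mem_ker, hφb] at h1
    exact MvPolynomial.X_ne_zero 1 h1

theorem hasFiberConeRank_Q' : HasFiberConeRank (Q' k) (SallyModule (Q' k) (I k)) 0 := by
  obtain ⟨⟨e, -⟩, hd, hne⟩ := gradedIso_Q'_and_isDomain k
  obtain ⟨-, h, ⟨e'⟩⟩ := hasFiberConeRank_of_linearEquiv e hd
  refine ⟨hd, h, ?_⟩
  let _ : Module (FiberCone (Q' k)) (SallyModule (Q' k) (I k)) := h.module
  -- The class of (x² + y² - w)t is a nonzero element of the domain B' that kills the whole module.
  refine e'.rank_eq.trans (rank_eq_zero_iff.mpr fun v => ⟨_, hne, ?_⟩)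
  obtain ⟨b, rfl⟩ := Ideal.Quotient.mk_surjective v
  exact Ideal.Quotient.eq_zero_iff_mem.mpr
    (Ideal.mul_mem_right b _ (Ideal.mem_span_singleton_self _))

end SallyExample

/-! ### The Hilbert function: counting monomials -/

/-- Restriction to k multiplies the length by that of the residue field over k, which is one because
k surjects onto it. -/
theorem length_eq_length_of_surjective_residueField {k A : Type*} (M : Type*) [Field k] [CommRing A]
    [IsLocalRing A] [Algebra k A] [AddCommGroup M] [Module k M] [Module A M] [IsScalarTower k A M]
    (h : Function.Surjective (algebraMap k (IsLocalRing.ResidueField A))) :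
    Module.length A M = Module.length k M := by
  rw [IsLocalRing.length_restrictScalars k A M, ← Module.length_eq_of_surjective
    (M := IsLocalRing.ResidueField A) (IsLocalRing.residue_surjective (R := k)),
    Module.length_eq_of_surjective h,
    Module.length_eq_one (IsLocalRing.ResidueField A) (IsLocalRing.ResidueField A), mul_one]

section LowerSetIdeal

variable {σ R : Type*} [CommRing R]

/-- The ideal of the power series that have no monomial in the lower set `S`. -/
noncomputable def MvPowerSeries.vanishingIdeal (S : LowerSet (σ →₀ ℕ)) :
    Ideal (MvPowerSeries σ R) where
  carrier := {f | ∀ e ∈ S, MvPowerSeries.coeff e f = 0}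
  zero_mem' _ _ := map_zero _
  add_mem' hf hg e he := by rw [map_add, hf e he, hg e he, add_zero]
  smul_mem' g f hf e he := by
    classical
    rw [smul_eq_mul, MvPowerSeries.coeff_mul]
    refine Finset.sum_eq_zero fun p hp => ?_
    rw [hf p.2 (S.lower (Finset.HasAntidiagonal.mem_antidiagonal.mp hp ▸ le_add_self) he), mul_zero]

theorem MvPowerSeries.monomial_mem_vanishingIdeal {S : LowerSet (σ →₀ ℕ)} {g : σ →₀ ℕ} (hg : g ∉ S)
    (r : R) : MvPowerSeries.monomial g r ∈ MvPowerSeries.vanishingIdeal (R := R) S := by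
  classical
  intro e he
  rw [MvPowerSeries.coeff_monomial, if_neg]
  rintro rfl
  exact hg he

end LowerSetIdeal

namespace SallyExample

/-- The exponent of the monomial `XᵃYᵇZⁱWʲ`. -/
noncomputable def exponent (p : (ℕ × ℕ) × ℕ × ℕ) : Fin 4 →₀ ℕ :=
  Finsupp.equivFunOnFinite.symm ![p.1.1, p.1.2, p.2.1, p.2.2]

theorem exponent_injective : Function.Injective exponent := by
  intro p q h
  have h := Finsupp.equivFunOnFinite.symm.injective h
  have h0 := congrFun h 0
  have h1 := congrFun h 1
  have h2 := congrFun h 2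
  have h3 := congrFun h 3
  exact Prod.ext (Prod.ext h0 h1) (Prod.ext h2 h3)

theorem exists_exponent_eq (e : Fin 4 →₀ ℕ) : exponent ((e 0, e 1), e 2, e 3) = e := by
  ext i
  fin_cases i <;> rfl

/-- The exponents of the monomials that are nonzero in `A` and have weight less than `2 m`, where
`X` and `Y` have weight `1` and `Z` and `W` have weight `2`. -/
def standardExponents (m : ℕ) : LowerSet (Fin 4 →₀ ℕ) where
  carrier := {e | ((e 2 = 0 ∧ e 3 = 0) ∨ (e 0 ≤ 1 ∧ e 1 ≤ 1)) ∧
    e 0 + e 1 + 2 * e 2 + 2 * e 3 < 2 * m}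
  lower' := by
    rintro e f h ⟨h1, h2⟩
    have h3 := h 0
    have h4 := h 1
    have h5 := h 2
    have h6 := h 3
    constructor <;> omega

theorem mem_standardExponents {m : ℕ} {e : Fin 4 →₀ ℕ} : e ∈ standardExponents m ↔
    ((e 2 = 0 ∧ e 3 = 0) ∨ (e 0 ≤ 1 ∧ e 1 ≤ 1)) ∧ e 0 + e 1 + 2 * e 2 + 2 * e 3 < 2 * m := Iff.rfl

/-- The pairs of natural numbers whose sum lies in `[a, b)`. -/
def pairsWithSum (a b : ℕ) : Finset (ℕ × ℕ) :=
  (Finset.Ico a b).biUnion Finset.HasAntidiagonal.antidiagonal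

theorem mem_pairsWithSum {a b : ℕ} {p : ℕ × ℕ} :
    p ∈ pairsWithSum a b ↔ a ≤ p.1 + p.2 ∧ p.1 + p.2 < b := by
  simp [pairsWithSum]

theorem card_pairsWithSum (a b : ℕ) : (pairsWithSum a b).card = ∑ d ∈ Finset.Ico a b, (d + 1) := by
  rw [pairsWithSum, Finset.card_biUnion]
  · simp
  · intro d _ e _ hde
    rw [Function.onFun, Finset.disjoint_left]
    intro p hp hq
    rw [Finset.HasAntidiagonal.mem_antidiagonal] at hp hq
    exact hde (hp.symm.trans hq)

theorem two_mul_card_pairsWithSum_zero (b : ℕ) : 2 * (pairsWithSum 0 b).card = b * (b + 1) := by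
  rw [card_pairsWithSum]
  induction b with
  | zero => rfl
  | succ b ih =>
    rw [Finset.sum_Ico_succ_top (Nat.zero_le b), mul_add, ih]
    ring

theorem card_pairsWithSum_one {b : ℕ} (hb : 1 ≤ b) :
    (pairsWithSum 1 b).card + 1 = (pairsWithSum 0 b).card := by
  rw [card_pairsWithSum, card_pairsWithSum, Finset.sum_eq_sum_Ico_succ_bot (a := 0) (by omega),
    zero_add, add_comm]

/-- The standard exponents as a finite set of tuples. -/
def standardTuples (m : ℕ) : Finset ((ℕ × ℕ) × ℕ × ℕ) :=
  (pairsWithSum 0 (2 * m) ×ˢ {(0, 0)}).disjUnion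
    ((({(0, 0), (0, 1), (1, 0)} : Finset (ℕ × ℕ)) ×ˢ pairsWithSum 1 m).disjUnion
      ({(1, 1)} ×ˢ pairsWithSum 1 (m - 1))
      (by
        rw [Finset.disjoint_left]
        rintro ⟨⟨a, b⟩, i, j⟩ h
        simp at h ⊢
        omega))
    (by
      rw [Finset.disjoint_left]
      rintro ⟨⟨a, b⟩, i, j⟩ h
      simp [mem_pairsWithSum] at h ⊢
      omega)

theorem exponent_mem_standardExponents {m : ℕ} {p : (ℕ × ℕ) × ℕ × ℕ} :
    exponent p ∈ standardExponents m ↔ p ∈ standardTuples m := by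
  obtain ⟨⟨a, b⟩, i, j⟩ := p
  have h0 : exponent ((a, b), i, j) 0 = a := rfl
  have h1 : exponent ((a, b), i, j) 1 = b := rfl
  have h2 : exponent ((a, b), i, j) 2 = i := rfl
  have h3 : exponent ((a, b), i, j) 3 = j := rfl
  rw [mem_standardExponents, h0, h1, h2, h3]
  simp [standardTuples, mem_pairsWithSum]
  omega

/-- Monomials in X, Y alone contribute m(2m + 1). With Z or W present, XᵃYᵇ is 1, X, Y or XY, and
the exponent sum of Z, W is at least 1 and below m, m, m, m - 1 respectively. Excluding sum zero in
these four families gives the -4; for XY this needs m - 1 ≥ 1. -/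
theorem card_standardTuples {m : ℕ} (hm : 2 ≤ m) :
    ((standardTuples m).card : ℤ) = 4 * m ^ 2 + 2 * m - 4 := by
  have h1 := two_mul_card_pairsWithSum_zero (2 * m)
  have h2 := two_mul_card_pairsWithSum_zero m
  have h3 := two_mul_card_pairsWithSum_zero (m - 1)
  have h4 := card_pairsWithSum_one (b := m) (by omega)
  have h5 := card_pairsWithSum_one (b := m - 1) (by omega)
  obtain ⟨r, rfl⟩ := Nat.exists_eq_add_of_le' hm
  rw [show r + 2 - 1 = r + 1 by omega] at h3 h5
  have h6 : (standardTuples (r + 2)).card = (pairsWithSum 0 (2 * (r + 2))).card +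
      (3 * (pairsWithSum 1 (r + 2)).card + (pairsWithSum 1 (r + 1)).card) := by
    rw [standardTuples, Finset.card_disjUnion, Finset.card_disjUnion, Finset.card_product,
      Finset.card_product, Finset.card_product]
    simp
  zify at h1 h2 h3 h4 h5 h6
  push_cast
  linarith

variable (k : Type*) [Field k]

theorem toExRing_monomial (e : Fin 4 →₀ ℕ) : toExRing k (MvPowerSeries.monomial e 1) =
    x k ^ e 0 * y k ^ e 1 * z k ^ e 2 * w k ^ e 3 := by
  rw [← MvPolynomial.coe_monomial, MvPolynomial.monomial_eq, MvPolynomial.C_1, one_mul,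
    Finsupp.prod_fintype _ _ (fun i => pow_zero _), Fin.prod_univ_four]
  simp [x, y, z, w]

/-- Pair the factors x and y into x², y² and, if both exponents are odd, one xy. At most one factor
of odd weight is left over, and since 2m is even it is not needed. -/
theorem monomial_mem_I_pow {a b c d m : ℕ} (h : 2 * m ≤ a + b + 2 * c + 2 * d) :
    x k ^ a * y k ^ b * z k ^ c * w k ^ d ∈ I k ^ m := by
  have h1 : x k ^ a * y k ^ b ∈ I k ^ ((a + b) / 2) := by
    have h2 := Ideal.mul_mem_mul (Ideal.pow_mem_pow (xx_mem k) (a / 2))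
      (Ideal.pow_mem_pow (yy_mem k) (b / 2))
    rw [← pow_add] at h2
    have h3 : x k ^ a * y k ^ b = (x k * x k) ^ (a / 2) * (y k * y k) ^ (b / 2) *
        (x k ^ (a % 2) * y k ^ (b % 2)) := by
      conv_lhs => rw [← Nat.div_add_mod a 2, ← Nat.div_add_mod b 2]
      ring
    rw [h3]
    by_cases hab : a % 2 = 1 ∧ b % 2 = 1
    · have h4 := Ideal.mul_mem_mul h2 (xy_mem k)
      rw [hab.1, hab.2, pow_one, pow_one]
      rw [← pow_succ] at h4
      exact Ideal.pow_le_pow_right (by omega) h4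
    · exact Ideal.mul_mem_right _ _ (Ideal.pow_le_pow_right (by omega) h2)
  have h2 := Ideal.mul_mem_mul (Ideal.mul_mem_mul h1 (Ideal.pow_mem_pow (z_mem k) c))
    (Ideal.pow_mem_pow (w_mem k) d)
  rw [← pow_add, ← pow_add] at h2
  exact Ideal.pow_le_pow_right (by omega) h2

theorem monomial_eq_zero {a b c d : ℕ} (h : 2 ≤ a ∨ 2 ≤ b) (h' : 1 ≤ c ∨ 1 ≤ d) :
    x k ^ a * y k ^ b * z k ^ c * w k ^ d = 0 := by
  rcases h with h | h <;> rcases h' with h' | h' <;>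
    obtain ⟨i, rfl⟩ := Nat.exists_eq_add_of_le' h <;> obtain ⟨j, rfl⟩ := Nat.exists_eq_add_of_le' h'
  · linear_combination x k ^ i * y k ^ b * z k ^ j * w k ^ d * xxz k
  · linear_combination x k ^ i * y k ^ b * z k ^ c * w k ^ j * xxw k
  · linear_combination x k ^ a * y k ^ i * z k ^ j * w k ^ d * yyz k
  · linear_combination x k ^ a * y k ^ i * z k ^ c * w k ^ j * yyw k

theorem relations_le_vanishingIdeal (m : ℕ) :
    relations k ≤ MvPowerSeries.vanishingIdeal (standardExponents m) := by
  let S₁ : LowerSet (Fin 4 →₀ ℕ) := ⟨{e | e 0 ≤ 1 ∧ e 1 ≤ 1}, fun e f h he =>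
    ⟨(h 0).trans he.1, (h 1).trans he.2⟩⟩
  let S₂ : LowerSet (Fin 4 →₀ ℕ) := ⟨{e | e 2 ≤ 0 ∧ e 3 ≤ 0}, fun e f h he =>
    ⟨(h 2).trans he.1, (h 3).trans he.2⟩⟩
  have h1 : Ideal.span {MvPowerSeries.X 0 ^ 2, MvPowerSeries.X 1 ^ 2} ≤
      MvPowerSeries.vanishingIdeal (R := k) S₁ := by
    rw [Ideal.span_le]
    rintro _ (rfl | rfl) <;> rw [MvPowerSeries.X_pow_eq] <;>
      refine MvPowerSeries.monomial_mem_vanishingIdeal ?_ _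
    · exact fun h => absurd h.1 (by simp)
    · exact fun h => absurd h.2 (by simp)
  have h2 : Ideal.span {MvPowerSeries.X 2, MvPowerSeries.X 3} ≤
      MvPowerSeries.vanishingIdeal (R := k) S₂ := by
    rw [Ideal.span_le]
    rintro _ (rfl | rfl) <;> refine MvPowerSeries.monomial_mem_vanishingIdeal ?_ _
    · exact fun h => absurd h.1 (by simp)
    · exact fun h => absurd h.2 (by simp)
  rintro f ⟨hf1, hf2⟩ e ⟨he | he, -⟩
  · exact h2 hf2 e ⟨he.1.le, he.2.le⟩
  · exact h1 hf1 e he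

/-- Each generator of I is a monomial of weight 2. Dividing a standard exponent of weight below 2(m
+ 1) by it leaves a standard exponent of weight below 2m. -/
theorem I_pow_le_map (m : ℕ) : I k ^ m ≤
    (MvPowerSeries.vanishingIdeal (standardExponents m)).map (toExRing k) := by
  induction m with
  | zero =>
    have : MvPowerSeries.vanishingIdeal (R := k) (standardExponents 0) = ⊤ := by
      rw [eq_top_iff]
      intro f _ e he
      have := (mem_standardExponents.mp he).2
      omega
    rw [this, Ideal.map_top]
    exact le_top
  | succ m ih =>
    rw [pow_succ']
    have h : ∀ g : Fin 4 →₀ ℕ, 2 ≤ g 0 + g 1 + 2 * g 2 + 2 * g 3 →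
        ∀ s ∈ (MvPowerSeries.vanishingIdeal (R := k) (standardExponents m)).map (toExRing k),
          x k ^ g 0 * y k ^ g 1 * z k ^ g 2 * w k ^ g 3 * s ∈
            (MvPowerSeries.vanishingIdeal (standardExponents (m + 1))).map (toExRing k) := by
      classical
      intro g hg s hs
      obtain ⟨f, hf, rfl⟩ := (Ideal.mem_map_iff_of_surjective _ (toExRing_surjective k)).mp hs
      rw [← toExRing_monomial, ← map_mul]
      refine Ideal.mem_map_of_mem _ fun e he => ?_
      rw [MvPowerSeries.coeff_monomial_mul]
      split_ifs with hge
      · rw [hf, mul_zero]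
        rw [mem_standardExponents] at he ⊢
        have h0 := hge 0
        have h1 := hge 1
        have h2 := hge 2
        have h3 := hge 3
        simp only [Finsupp.tsub_apply]
        omega
      · rfl
    refine (Ideal.mul_mono_right ih).trans (I_mul_le k ?_ ?_ ?_ ?_ ?_) <;> intro s hs
    · simpa [exponent, pow_two] using h (exponent ((2, 0), 0, 0)) (by simp [exponent]) s hs
    · simpa [exponent] using h (exponent ((1, 1), 0, 0)) (by simp [exponent]) s hs
    · simpa [exponent, pow_two] using h (exponent ((0, 2), 0, 0)) (by simp [exponent]) s hs
    · simpa [exponent] using h (exponent ((0, 0), 1, 0)) (by simp [exponent]) s hs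
    · simpa [exponent] using h (exponent ((0, 0), 0, 1)) (by simp [exponent]) s hs

/-- I^m is a monomial ideal in A: membership only depends on which monomials occur in a
representative. This gives a monomial basis of A/I^m. -/
theorem toExRing_mem_I_pow_iff (m : ℕ) (f : MvPowerSeries (Fin 4) k) :
    toExRing k f ∈ I k ^ m ↔ f ∈ MvPowerSeries.vanishingIdeal (standardExponents m) := by
  classical
  constructor
  · intro h
    obtain ⟨g, hg, hgf⟩ := (Ideal.mem_map_iff_of_surjective _ (toExRing_surjective k)).mp
      (I_pow_le_map k m h)
    rw [← sub_add_cancel f g]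
    refine add_mem (relations_le_vanishingIdeal k m (Ideal.Quotient.eq_zero_iff_mem.mp ?_)) hg
    change toExRing k (f - g) = 0
    rw [map_sub, hgf, sub_self]
  · intro hf
    -- Exponents are cut off at 2m + 2 so that finitely many monomials suffice. A truncated exponent
    -- still has weight at least 2m, and being at least 2 it still makes a monomial vanish that
    -- vanished before.
    let b : Fin 4 →₀ ℕ := Finsupp.equivFunOnFinite.symm fun _ => 2 * m + 2
    have hb : ∀ (e : Fin 4 →₀ ℕ) i, (e ⊓ b) i = min (e i) (2 * m + 2) := fun e i => rfl
    have h := MvPowerSeries.mem_span_of_support ((Finset.Iic b).filter fun g =>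
      toExRing k (MvPowerSeries.monomial g 1) ∈ I k ^ m) f ?_
    · rw [← Ideal.mem_comap]
      refine Ideal.span_le.mpr ?_ h
      rintro _ ⟨g, hg, rfl⟩
      exact (Finset.mem_filter.mp hg).2
    · intro e he
      have he' : e ∉ standardExponents m := fun h => he (hf e h)
      refine ⟨e ⊓ b, Finset.mem_filter.mpr ⟨Finset.mem_Iic.mpr inf_le_right, ?_⟩, inf_le_left⟩
      rw [toExRing_monomial]
      simp only [hb]
      rw [mem_standardExponents] at he'
      by_cases h1 : (e 2 = 0 ∧ e 3 = 0) ∨ (e 0 ≤ 1 ∧ e 1 ≤ 1)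
      · apply monomial_mem_I_pow
        omega
      · rw [monomial_eq_zero k (by omega) (by omega)]
        exact zero_mem _

theorem length_quotient_I_pow (m : ℕ) :
    Module.length (ExRing k) (ExRing k ⧸ I k ^ m) = (standardTuples m).card := by
  let _ : Algebra k (ExRing k) := ((toExRing k).comp MvPowerSeries.C).toAlgebra
  have hs : Function.Surjective (algebraMap k (IsLocalRing.ResidueField (ExRing k))) := by
    intro r
    obtain ⟨r, rfl⟩ := IsLocalRing.residue_surjective r
    refine ⟨residue k r, ?_⟩
    change IsLocalRing.residue _ (toExRing k (MvPowerSeries.C (residue k r))) = _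
    rw [← sub_eq_zero, ← map_sub, IsLocalRing.residue_eq_zero_iff, ← ker_residue, RingHom.mem_ker,
      map_sub, residue_toExRing, MvPowerSeries.constantCoeff_C, sub_self]
  rw [length_eq_length_of_surjective_residueField _ hs]
  let c : MvPowerSeries (Fin 4) k →ₗ[k] (standardTuples m → k) :=
    LinearMap.pi fun p => MvPowerSeries.coeff (exponent p)
  have hc : Function.Surjective c := by
    intro v
    -- The series with the prescribed coefficients at the standard exponents and zero elsewhere.
    refine ⟨Function.extend (fun p : standardTuples m => exponent p) v 0, ?_⟩
    funext p
    exact (exponent_injective.comp Subtype.val_injective).extend_apply v 0 p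
  let t : MvPowerSeries (Fin 4) k →ₗ[k] (ExRing k ⧸ I k ^ m) :=
    { toFun := fun f => Ideal.Quotient.mk (I k ^ m) (toExRing k f)
      map_add' := fun f g => by rw [map_add, map_add]
      map_smul' := fun a f => by
        rw [MvPowerSeries.smul_eq_C_mul, map_mul, map_mul]
        rfl }
  have ht : Function.Surjective t := fun r => by
    obtain ⟨r, rfl⟩ := Ideal.Quotient.mk_surjective r
    obtain ⟨f, rfl⟩ := toExRing_surjective k r
    exact ⟨f, rfl⟩
  have hk : LinearMap.ker t = LinearMap.ker c := by
    ext f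
    rw [LinearMap.mem_ker, LinearMap.mem_ker]
    refine Ideal.Quotient.eq_zero_iff_mem.trans ((toExRing_mem_I_pow_iff k m f).trans ?_)
    constructor
    · intro h
      funext p
      exact h _ (exponent_mem_standardExponents.mpr p.2)
    · intro h e he
      rw [← exists_exponent_eq e] at he ⊢
      exact congrFun h ⟨_, exponent_mem_standardExponents.mp he⟩
  rw [((t.quotKerEquivOfSurjective ht).symm.trans ((Submodule.quotEquivOfEq _ _ hk).trans
    (c.quotKerEquivOfSurjective hc))).length_eq, Module.length_eq_finrank]
  simp

end SallyExample

theorem mainTheorem9 (k : Type*) [Field k] :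
    -- `Q` and `Q'` are minimal reductions of `I`, and `I` is the integral closure of both
    IsMinimalIdealReduction (SallyExample.Q k) (SallyExample.I k) ∧
    IsMinimalIdealReduction (SallyExample.Q' k) (SallyExample.I k) ∧
    (SallyExample.I k : Set (SallyExample.ExRing k)) =
      idealIntegralClosure (SallyExample.Q k) ∧
    (SallyExample.I k : Set (SallyExample.ExRing k)) =
      idealIntegralClosure (SallyExample.Q' k) ∧
    -- `S_Q(I) ≅ B₊` as graded `R(Q)`-modules
    GradedIso (Rees (SallyExample.Q k))
      (sallyDegree (SallyExample.Q k) (SallyExample.I k))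
      (fiberConePlusDegree (SallyExample.Q k)) ∧
    -- `S_{Q'}(I) ≅ (B' / (x² + y² - w) t B')(-1)` as graded `R(Q')`-modules
    GradedIso (Rees (SallyExample.Q' k))
      (sallyDegree (SallyExample.Q' k) (SallyExample.I k))
      (shiftDegree (inducedDegree (SallyExample.Q' k)
        (FiberConeMod (SallyExample.Q' k) _ (SallyExample.b'_mem k)))) ∧
    -- the Hilbert function of `I`
    (∀ n : ℕ, 1 ≤ n → ∃ ℓ : ℕ,
      Module.length (SallyExample.ExRing k)
        (SallyExample.ExRing k ⧸ SallyExample.I k ^ (n + 1)) = (ℓ : ℕ∞) ∧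
      (ℓ : ℤ) = 8 * ((n + 2).choose 2 : ℤ) - 2 * ((n + 1).choose 1 : ℤ) - 4) ∧
    -- the ranks of the two Sally modules over `B` and `B'`
    HasFiberConeRank (SallyExample.Q k)
      (SallyModule (SallyExample.Q k) (SallyExample.I k)) 1 ∧
    HasFiberConeRank (SallyExample.Q' k)
      (SallyModule (SallyExample.Q' k) (SallyExample.I k)) 0 := by
  have hQ := (SallyExample.hasQuadraticArcs_Q k).isMinimalIdealReduction
    (SallyExample.residue_surjective k) (SallyExample.ker_residue k) (SallyExample.Q_eq k)
    (SallyExample.isIdealReduction_Q k)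
  have hQ' := (SallyExample.hasQuadraticArcs_Q' k).isMinimalIdealReduction
    (SallyExample.residue_surjective k) (SallyExample.ker_residue k) (SallyExample.Q'_eq k)
    (SallyExample.isIdealReduction_Q' k)
  refine ⟨hQ, hQ', ?_, ?_, (SallyExample.gradedIso_Q_and_isDomain k).1,
    (SallyExample.gradedIso_Q'_and_isDomain k).1, ?_, SallyExample.hasFiberConeRank_Q k,
    SallyExample.hasFiberConeRank_Q' k⟩
  · exact Set.Subset.antisymm
      (fun _ hr => mem_idealIntegralClosure_of_isIdealReduction (SallyExample.I_fg k) hQ.1 hr)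
      (fun _ hr => SallyExample.mem_I_of_mem_idealIntegralClosure k (SallyExample.Q_le k) hr)
  · exact Set.Subset.antisymm
      (fun _ hr => mem_idealIntegralClosure_of_isIdealReduction (SallyExample.I_fg k) hQ'.1 hr)
      (fun _ hr => SallyExample.mem_I_of_mem_idealIntegralClosure k (SallyExample.Q'_le k) hr)
  · intro n hn
    refine ⟨_, SallyExample.length_quotient_I_pow k (n + 1), ?_⟩
    -- With m = n + 1 the count is 4m² + 2m - 4 = 4m(m + 1) - 2m - 4, and 4m(m + 1) is 8 times the
    -- binomial coefficient of m + 1 over 2.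
    rw [SallyExample.card_standardTuples (by omega), Nat.choose_one_right]
    have h : (n + 2).choose 2 * 2 = (n + 2) * (n + 1) := by
      rw [Nat.choose_two_right]
      exact Nat.div_mul_cancel (Nat.even_mul_pred_self (n + 2)).two_dvd
    zify at h
    push_cast
    linear_combination -4 * h
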